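/- Let $S=\mathbb C[X_1,\dots,X_n]$ be a polynomial ring with its standard grading, and let $W$ be a finite group acting on $S$ by $\mathbb C$-algebra automorphisms that preserve the grading. Assume that every finite-dimensional complex representation of $W$ is self-dual and that $S/I$ is finite-dimensional, where $I$ is the ideal of $S$ generated by the homogeneous $W$-invariants of positive degree. Let $A=S*W$ be the skew group algebra, that is, $S\otimes\mathbb C W$ with the multiplication $(s\otimes w)(s'\otimes w')=s\,w(s')\otimes ww'$ and the grading $A_i=S_i\otimes\mathbb C W$, and let $A\text{-gmod}$ be the category of finitely generated $\mathbb Z$-graded left $A$-modules with homomorphisms of degree $0$. For $M\in A\text{-gmod}$ and $d\in\mathbb Z$ let $M\langle d\rangle$ be the shift $M\langle d\rangle_i=M_{i-d}$, and put $\mathrm{Ext}^i_A(M,N)_d=\mathrm{Ext}^i_{A\text{-gmod}}(M,N\langle -d\rangle)$ and $\mathrm{gdim}\,\mathrm{Ext}^i_A(M,N)=\sum_{d\in\mathbb Z}q^d\dim\mathrm{Ext}^i_A(M,N)_d$. For a finite-dimensional $M$ the dual $M^*=\mathrm{Hom}_{\mathbb C}(M,\mathbb C)$ is the graded left $A$-module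 with $((s\otimes w)f)(m)=f((w^{-1}(s)\otimes w^{-1})m)$ and $(M^*)_i=\mathrm{Hom}_{\mathbb C}(M_{-i},\mathbb C)$. Let $\mathrm{Irr}(W)$ be the set of isomorphism classes of irreducible complex representations of $W$. For $\lambda\in\mathrm{Irr}(W)$ let $P_\lambda=S\otimes\lambda$, with $(P_\lambda)_i=S_i\otimes\lambda$ and $(s\otimes w)(p\otimes v)=s\,w(p)\otimes wv$. Let $\precsim$ be a preorder on $\mathrm{Irr}(W)$, write $\lambda\prec\mu$ if $\lambda\precsim\mu$ and not $\mu\precsim\lambda$, and put $$K_\lambda=P_\lambda\Big/\sum_{\lambda\precsim\mu,\ d>0,\ f:P_\mu\langle d\rangle\to P_\lambda}\mathrm{Im}\,f,\qquad \widetilde K_\lambda=P_\lambda\Big/\sum_{\lambda\prec\mu,\ d>0,\ f:P_\mu\langle d\rangle\to P_\lambda}\mathrm{Im}\,f,$$ where $f$ runs over homomorphisms in $A\text{-gmod}$; the modules $K_\lambda$ are finite-dimensional. Put $[M:L_\lambda]_q=\sum_{d}q^d[M_d:\lambda]$, where $[M_d:\lambda]$ is the multiplicity of $\lambda$ in the $W$-representation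 $M_d$. For a family $F=\{F_\alpha\}$ in $A\text{-gmod}$, an $F$-filtration of $M$ is a sequence of graded submodules $M=M^0\supseteq M^1\supseteq M^2\supseteq\cdots$ with $\bigcap_i M^i=0$, each of whose factors $M^{i-1}/M^i$ is zero or isomorphic to $F_\alpha\langle d\rangle$ for some $\alpha$ and $d$; the multiplicity of $F_\alpha$ in it is $\sum_d m_dq^d$, where $m_d$ is the number of factors isomorphic to $F_\alpha\langle d\rangle$. Assume that for every $\lambda\in\mathrm{Irr}(W)$ the module $P_\lambda$ has a $\{\widetilde K_\mu\}$-filtration and the module $\widetilde K_\lambda$ has a $\{K_\mu\}$-filtration. If, for every $\lambda$, the module $P_\lambda$ has a $\{\widetilde K_\mu\}$-filtration in which, for every $\mu$, the multiplicity of $\widetilde K_\mu$ is $[K_\mu:L_\lambda]_q$, then for all $i\ge 0$ and all $\lambda,\mu\in\mathrm{Irr}(W)$ $$\mathrm{gdim}\,\mathrm{Ext}^i_A(\widetilde K_\lambda,K_\mu^*)=\begin{cases}1&\text{if } i=0 \text{ and } \lambda=\mu,\\ 0&\text{otherwise.}\end{cases}$$ -/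

import Mathlib

open CategoryTheory CategoryTheory.Limits
open scoped TensorProduct

universe uk uA

noncomputable section

/-! ## Finitely generated graded modules over a graded algebra -/

/-- A finitely generated `ℤ`-graded left module over the `k`-algebra `A` whose homogeneous part of
degree `i` is `𝒜 i`. -/
structure GrMod {k A : Type*} [Field k] [Ring A] [Algebra k A] (𝒜 : ℤ → Submodule k A) where
  carrier : Type
  [addCommGroup : AddCommGroup carrier]
  [module : Module k carrier]
  [moduleA : Module A carrier]
  [tower : IsScalarTower k A carrier]
  [finite : Module.Finite A carrier]
  /-- the homogeneous part of degree `i` -/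
  deg : ℤ → Submodule k carrier
  isInternal : DirectSum.IsInternal deg
  smul_mem : ∀ {i j : ℤ} {a : A} {m : carrier}, a ∈ 𝒜 i → m ∈ deg j → a • m ∈ deg (i + j)

namespace GrMod

attribute [instance] addCommGroup module moduleA tower finite

section internal

variable {k M : Type*} [Field k] [AddCommGroup M] [Module k M]

/-- A family of submodules that generates and admits compatible projections is a grading. -/
theorem isInternal_of_proj (deg : ℤ → Submodule k M) (p : ℤ → M →ₗ[k] M)
    (h1 : ∀ i, ∀ m ∈ deg i, p i m = m) (h2 : ∀ i j, i ≠ j → ∀ m ∈ deg i, p j m = 0)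
    (h3 : ∀ m, m ∈ ⨆ i, deg i) : DirectSum.IsInternal deg := by
  rw [DirectSum.isInternal_submodule_iff_iSupIndep_and_iSup_eq_top]
  refine ⟨?_, eq_top_iff.2 fun m _ => h3 m⟩
  intro i
  rw [Submodule.disjoint_def]
  intro x hx hx'
  rw [← h1 i x hx]
  have : (⨆ j, ⨆ (_ : j ≠ i), deg j) ≤ LinearMap.ker (p i) :=
    iSup_le fun j => iSup_le fun hj m hm => h2 j i hj m hm
  exact this hx'

end internal

variable {k A : Type*} [Field k] [Ring A] [Algebra k A] {𝒜 : ℤ → Submodule k A}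

/-- The projection of a graded module to its homogeneous part of degree `i`. -/
def proj (M : GrMod 𝒜) (i : ℤ) : M.carrier →ₗ[k] M.carrier :=
  (M.deg i).subtype ∘ₗ DirectSum.component k ℤ (fun i => M.deg i) i ∘ₗ
    (LinearEquiv.ofBijective (DirectSum.coeLinearMap M.deg) M.isInternal).symm.toLinearMap

theorem proj_mem (M : GrMod 𝒜) (i : ℤ) (m : M.carrier) : M.proj i m ∈ M.deg i := by
  simp [proj]

theorem symm_of_mem (M : GrMod 𝒜) {i : ℤ} {m : M.carrier} (hm : m ∈ M.deg i) :
    (LinearEquiv.ofBijective (DirectSum.coeLinearMap M.deg) M.isInternal).symm m =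
      DirectSum.lof k ℤ (fun i => M.deg i) i ⟨m, hm⟩ := by
  rw [LinearEquiv.symm_apply_eq]
  exact (DirectSum.coeLinearMap_lof M.deg i ⟨m, hm⟩).symm

theorem proj_of_mem (M : GrMod 𝒜) {i : ℤ} {m : M.carrier} (hm : m ∈ M.deg i) :
    M.proj i m = m := by
  simp [proj, symm_of_mem M hm]

theorem proj_of_mem_ne (M : GrMod 𝒜) {i j : ℤ} (hij : i ≠ j) {m : M.carrier} (hm : m ∈ M.deg i) :
    M.proj j m = 0 := by
  simp only [proj, LinearMap.comp_apply, LinearEquiv.coe_coe, symm_of_mem M hm]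
  exact congrArg Subtype.val (DirectSum.of_eq_of_ne (β := fun i => M.deg i) i j ⟨m, hm⟩ hij.symm)

theorem iSup_deg (M : GrMod 𝒜) : ⨆ i, M.deg i = ⊤ := M.isInternal.submodule_iSup_eq_top

theorem exists_sum_proj (M : GrMod 𝒜) (m : M.carrier) :
    ∃ s : Finset ℤ, m = ∑ i ∈ s, M.proj i m := by
  classical
  have hm : m ∈ ⨆ i, M.deg i := by rw [M.iSup_deg]; trivial
  suffices ∃ s : Finset ℤ, ∀ t : Finset ℤ, s ⊆ t → m = ∑ i ∈ t, M.proj i m from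
    this.imp fun s hs => hs s subset_rfl
  induction hm using Submodule.iSup_induction' with
  | mem i x hx =>
    refine ⟨{i}, fun t ht => ?_⟩
    rw [Finset.sum_eq_single i (fun j _ hj => M.proj_of_mem_ne hj.symm hx)
      (fun h => absurd (ht (by simp)) h), M.proj_of_mem hx]
  | zero => exact ⟨∅, by simp⟩
  | add x y _ _ hx hy =>
    obtain ⟨s, hs⟩ := hx
    obtain ⟨t, ht⟩ := hy
    refine ⟨s ∪ t, fun u hu => ?_⟩
    simp only [map_add, Finset.sum_add_distrib]
    rw [← hs u (Finset.union_subset_left hu), ← ht u (Finset.union_subset_right hu)]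

/-- Two maps that agree on homogeneous elements agree. -/
theorem ext_deg (M : GrMod 𝒜) {N : Type*} [AddCommGroup N] [Module k N]
    {f g : M.carrier →ₗ[k] N} (h : ∀ i, ∀ m ∈ M.deg i, f m = g m) : f = g := by
  ext m
  obtain ⟨s, hs⟩ := M.exists_sum_proj m
  rw [hs, map_sum, map_sum]
  exact Finset.sum_congr rfl fun i _ => h i _ (M.proj_mem i m)

/-- A graded homomorphism of degree `0`. -/
@[ext]
structure Hom (M N : GrMod 𝒜) where
  hom : M.carrier →ₗ[A] N.carrier
  map_deg : ∀ (i : ℤ), ∀ m ∈ M.deg i, hom m ∈ N.deg i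

instance : Category (GrMod 𝒜) where
  Hom M N := Hom M N
  id M := ⟨LinearMap.id, fun _ _ h => h⟩
  comp f g := ⟨g.hom ∘ₗ f.hom, fun i m h => g.map_deg i _ (f.map_deg i m h)⟩

/-- The underlying linear map of a morphism. -/
abbrev lin {M N : GrMod 𝒜} (f : M ⟶ N) : M.carrier →ₗ[A] N.carrier := Hom.hom f

@[ext]
theorem hom_ext {M N : GrMod 𝒜} {f g : M ⟶ N} (h : ∀ m, lin f m = lin g m) : f = g :=
  Hom.ext (LinearMap.ext h)

@[simp] theorem lin_id (M : GrMod 𝒜) : lin (𝟙 M) = LinearMap.id := rfl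
@[simp] theorem lin_comp {M N L : GrMod 𝒜} (f : M ⟶ N) (g : N ⟶ L) :
    lin (f ≫ g) = lin g ∘ₗ lin f := rfl

theorem lin_proj {M N : GrMod 𝒜} (f : M ⟶ N) (i : ℤ) (m : M.carrier) :
    lin f (M.proj i m) = N.proj i (lin f m) := by
  have : (lin f).restrictScalars k ∘ₗ M.proj i = N.proj i ∘ₗ (lin f).restrictScalars k := by
    refine M.ext_deg fun j x hx => ?_
    by_cases h : j = i
    · subst h
      simp [M.proj_of_mem hx, N.proj_of_mem (f.map_deg j x hx)]
    · simp [M.proj_of_mem_ne h hx, N.proj_of_mem_ne h (f.map_deg j x hx)]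
  exact LinearMap.congr_fun this m

/-! ### The linear structure -/

section linear

variable {M N : GrMod 𝒜}

instance : Zero (M ⟶ N) := ⟨⟨0, fun _ _ _ => Submodule.zero_mem _⟩⟩
instance : Add (M ⟶ N) :=
  ⟨fun f g => ⟨lin f + lin g, fun i m h =>
    Submodule.add_mem _ (f.map_deg i m h) (g.map_deg i m h)⟩⟩
instance : Neg (M ⟶ N) :=
  ⟨fun f => ⟨-lin f, fun i m h => Submodule.neg_mem _ (f.map_deg i m h)⟩⟩
instance : Sub (M ⟶ N) :=
  ⟨fun f g => ⟨lin f - lin g, fun i m h =>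
    Submodule.sub_mem _ (f.map_deg i m h) (g.map_deg i m h)⟩⟩
instance {R : Type*} [Semiring R] [Module R k] [Module R N.carrier] [SMulCommClass A R N.carrier]
    [IsScalarTower R k N.carrier] : SMul R (M ⟶ N) :=
  ⟨fun r f => ⟨r • lin f, fun i m h =>
    (Submodule.restrictScalars R (N.deg i)).smul_mem r (f.map_deg i m h)⟩⟩

theorem lin_injective : Function.Injective (lin : (M ⟶ N) → (M.carrier →ₗ[A] N.carrier)) :=
  fun _ _ h => Hom.ext h

@[simp] theorem lin_zero : lin (0 : M ⟶ N) = 0 := rfl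
@[simp] theorem lin_add (f g : M ⟶ N) : lin (f + g) = lin f + lin g := rfl
@[simp] theorem lin_neg (f : M ⟶ N) : lin (-f) = -lin f := rfl
@[simp] theorem lin_sub (f g : M ⟶ N) : lin (f - g) = lin f - lin g := rfl
@[simp] theorem lin_smul (c : k) (f : M ⟶ N) : lin (c • f) = c • lin f := rfl

instance : AddCommGroup (M ⟶ N) :=
  lin_injective.addCommGroup _ rfl (fun _ _ => rfl) (fun _ => rfl) (fun _ _ => rfl)
    (fun _ _ => rfl) (fun _ _ => rfl)

instance : Module k (M ⟶ N) :=
  lin_injective.module k ⟨⟨lin, rfl⟩, fun _ _ => rfl⟩ (fun _ _ => rfl)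

end linear

instance : Preadditive (GrMod 𝒜) where
  add_comp _ _ _ f f' g := hom_ext fun m => (lin g).map_add _ _
  comp_add _ _ _ f g g' := rfl

instance : Linear k (GrMod 𝒜) where
  smul_comp _ _ _ r f g := hom_ext fun m => ((lin g).restrictScalars k).map_smul r _
  comp_smul _ _ _ f r g := rfl

/-! ### Graded submodules, quotients, shifts, products -/

/-- A graded (that is, homogeneous) submodule. -/
@[ext]
structure GrSub (M : GrMod 𝒜) where
  toSubmodule : Submodule A M.carrier
  proj_mem' : ∀ (i : ℤ), ∀ m ∈ toSubmodule, M.proj i m ∈ toSubmodule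

/-- The kernel of a morphism. -/
def ker {M N : GrMod 𝒜} (f : M ⟶ N) : GrSub M where
  toSubmodule := LinearMap.ker (lin f)
  proj_mem' i m hm := by
    rw [LinearMap.mem_ker] at hm ⊢
    rw [lin_proj, hm, map_zero]

/-- The image of a morphism. -/
def range {M N : GrMod 𝒜} (f : M ⟶ N) : GrSub N where
  toSubmodule := LinearMap.range (lin f)
  proj_mem' i m hm := by
    obtain ⟨x, rfl⟩ := hm
    exact ⟨M.proj i x, lin_proj f i x⟩

/-- The preimage of a graded submodule. -/
def GrSub.comap {M N : GrMod 𝒜} (f : M ⟶ N) (L : GrSub N) : GrSub M where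
  toSubmodule := L.toSubmodule.comap (lin f)
  proj_mem' i m hm := by
    rw [Submodule.mem_comap, lin_proj]
    exact L.proj_mem' i _ hm

/-- The sum of a family of graded submodules. -/
def GrSub.iSup {M : GrMod 𝒜} {ι : Type*} (L : ι → GrSub M) : GrSub M where
  toSubmodule := ⨆ j, (L j).toSubmodule
  proj_mem' i m hm := by
    induction hm using Submodule.iSup_induction' with
    | mem j x hx => exact Submodule.mem_iSup_of_mem j ((L j).proj_mem' i x hx)
    | zero => simp
    | add x y _ _ hx hy => rw [map_add]; exact Submodule.add_mem _ hx hy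

/-- The quotient of a graded module by a graded submodule. -/
def quot (M : GrMod 𝒜) (L : GrSub M) : GrMod 𝒜 where
  carrier := M.carrier ⧸ L.toSubmodule
  deg i := (M.deg i).map (L.toSubmodule.mkQ.restrictScalars k)
  isInternal := by
    refine isInternal_of_proj _
      (fun i => ((L.toSubmodule.restrictScalars k).mapQ (L.toSubmodule.restrictScalars k)
        (M.proj i) (fun m hm => L.proj_mem' i m hm) :)) ?_ ?_ ?_
    · rintro i _ ⟨x, hx, rfl⟩
      exact congrArg L.toSubmodule.mkQ (M.proj_of_mem hx)
    · rintro i j hij _ ⟨x, hx, rfl⟩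
      exact (congrArg L.toSubmodule.mkQ (M.proj_of_mem_ne hij hx)).trans (map_zero _)
    · intro m
      obtain ⟨x, rfl⟩ := L.toSubmodule.mkQ_surjective m
      rw [← Submodule.map_iSup, M.iSup_deg]
      exact ⟨x, trivial, rfl⟩
  smul_mem := by
    rintro i j a _ ha ⟨x, hx, rfl⟩
    exact ⟨a • x, M.smul_mem ha hx, rfl⟩

/-- The quotient map. -/
def mkQ (M : GrMod 𝒜) (L : GrSub M) : M ⟶ M.quot L :=
  Hom.mk (M := M) (N := M.quot L) L.toSubmodule.mkQ fun _ m hm => ⟨m, hm, rfl⟩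

/-- The grade `d` shift `M⟨d⟩` of `M`, with `M⟨d⟩_i = M_{i-d}`. -/
def shift (M : GrMod 𝒜) (d : ℤ) : GrMod 𝒜 where
  carrier := M.carrier
  deg i := M.deg (i - d)
  isInternal := by
    refine isInternal_of_proj _ (fun i => M.proj (i - d)) (fun i m hm => M.proj_of_mem hm)
      (fun i j hij m hm => M.proj_of_mem_ne (by omega) hm) fun m => ?_
    have : ⨆ i, M.deg (i - d) = ⨆ i, M.deg i := (Equiv.subRight d).iSup_comp (g := M.deg)
    rw [this, M.iSup_deg]
    trivial
  smul_mem {i j a m} ha hm := by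
    rw [add_sub_assoc]
    exact M.smul_mem ha hm

/-- The zero module. -/
def zeroObj : GrMod 𝒜 where
  carrier := PUnit
  deg _ := ⊤
  isInternal := isInternal_of_proj _ 0 (fun _ _ _ => rfl) (fun _ _ _ _ _ => rfl)
    (fun _ => by simp)
  smul_mem _ _ := trivial

instance : HasZeroObject (GrMod 𝒜) :=
  ⟨zeroObj, (IsZero.iff_id_eq_zero _).2 (hom_ext fun _ => rfl)⟩

/-- The direct sum of two graded modules. -/
def prod (M N : GrMod 𝒜) : GrMod 𝒜 where
  carrier := M.carrier × N.carrier
  deg i := (M.deg i).prod (N.deg i)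
  isInternal := by
    refine isInternal_of_proj _ (fun i => (M.proj i).prodMap (N.proj i)) ?_ ?_ ?_
    · rintro i ⟨x, y⟩ ⟨hx, hy⟩
      exact Prod.ext (M.proj_of_mem hx) (N.proj_of_mem hy)
    · rintro i j hij ⟨x, y⟩ ⟨hx, hy⟩
      exact Prod.ext (M.proj_of_mem_ne hij hx) (N.proj_of_mem_ne hij hy)
    · rintro ⟨x, y⟩
      have h1 : (⨆ i, M.deg i).map (LinearMap.inl k M.carrier N.carrier) ≤
          ⨆ i, (M.deg i).prod (N.deg i) := by
        rw [Submodule.map_iSup]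
        refine iSup_mono fun i => ?_
        rintro _ ⟨x, hx, rfl⟩
        exact ⟨hx, Submodule.zero_mem _⟩
      have h2 : (⨆ i, N.deg i).map (LinearMap.inr k M.carrier N.carrier) ≤
          ⨆ i, (M.deg i).prod (N.deg i) := by
        rw [Submodule.map_iSup]
        refine iSup_mono fun i => ?_
        rintro _ ⟨x, hx, rfl⟩
        exact ⟨Submodule.zero_mem _, hx⟩
      rw [M.iSup_deg] at h1
      rw [N.iSup_deg] at h2
      have := Submodule.add_mem _ (h1 ⟨x, trivial, rfl⟩) (h2 ⟨y, trivial, rfl⟩)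
      simpa using this
  smul_mem ha hm := ⟨M.smul_mem ha hm.1, N.smul_mem ha hm.2⟩

instance : HasBinaryProducts (GrMod 𝒜) :=
  @hasBinaryProducts_of_hasLimit_pair _ _ fun {M N} => HasLimit.mk
    { cone := BinaryFan.mk (P := M.prod N)
        (Hom.mk (M := M.prod N) (N := M) (LinearMap.fst A _ _) fun _ _ h => h.1)
        (Hom.mk (M := M.prod N) (N := N) (LinearMap.snd A _ _) fun _ _ h => h.2)
      isLimit := BinaryFan.isLimitMk
        (fun s => Hom.mk (M := s.pt) (N := M.prod N) (LinearMap.prod (lin s.fst) (lin s.snd))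
          fun i m h => ⟨s.fst.map_deg i m h, s.snd.map_deg i m h⟩)
        (fun s => rfl) (fun s => rfl)
        (fun s f h1 h2 => hom_ext fun m => Prod.ext (by rw [← h1]; rfl) (by rw [← h2]; rfl)) }

instance : HasFiniteProducts (GrMod 𝒜) := hasFiniteProducts_of_has_binary_and_terminal

theorem surjective_of_epi {M N : GrMod 𝒜} (f : M ⟶ N) [Epi f] :
    Function.Surjective (lin f) := by
  rw [← LinearMap.range_eq_top, eq_top_iff]
  intro m _
  have : N.mkQ (range f) = 0 := by
    rw [← cancel_epi f, comp_zero]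
    exact hom_ext fun m => (Submodule.Quotient.mk_eq_zero _).2 ⟨m, rfl⟩
  exact (Submodule.Quotient.mk_eq_zero _).1 (LinearMap.congr_fun (congrArg lin this) m)

/-- An injective morphism is a kernel of its cokernel. -/
theorem normalMono {M N : GrMod 𝒜} (f : M ⟶ N) (hf : Function.Injective (lin f)) :
    Nonempty (NormalMono f) := Nonempty.intro {
  Z := N.quot (range f)
  g := N.mkQ (range f)
  w := hom_ext fun m => (Submodule.Quotient.mk_eq_zero _).2 ⟨m, rfl⟩
  isLimit := KernelFork.IsLimit.ofι _ _
    (fun {T} g hg => Hom.mk (M := T) (N := M)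
      ((LinearEquiv.ofInjective (lin f) hf).symm.toLinearMap ∘ₗ
        (lin g).codRestrict (LinearMap.range (lin f)) fun t =>
          (Submodule.Quotient.mk_eq_zero _).1 (LinearMap.congr_fun (congrArg lin hg) t))
      (fun i t ht => by
        set x := ((LinearEquiv.ofInjective (lin f) hf).symm.toLinearMap ∘ₗ
          (lin g).codRestrict (LinearMap.range (lin f)) fun t =>
          (Submodule.Quotient.mk_eq_zero _).1 (LinearMap.congr_fun (congrArg lin hg) t)) t with hx
        have hfx : lin f x = lin g t :=
          congrArg Subtype.val ((LinearEquiv.ofInjective (lin f) hf).apply_symm_apply _)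
        have : M.proj i x = x := hf (by
          rw [lin_proj, hfx]
          exact N.proj_of_mem (g.map_deg i t ht))
        rw [← this]
        exact M.proj_mem i x))
    (fun g hg => hom_ext fun t =>
      congrArg Subtype.val ((LinearEquiv.ofInjective (lin f) hf).apply_symm_apply _))
    (fun {T} g hg m hm => hom_ext fun t => hf ((LinearMap.congr_fun (congrArg lin hm) t).trans
      (congrArg Subtype.val ((LinearEquiv.ofInjective (lin f) hf).apply_symm_apply
        ((lin g).codRestrict (LinearMap.range (lin f)) (fun t =>
          (Submodule.Quotient.mk_eq_zero _).1 (LinearMap.congr_fun (congrArg lin hg) t)) t))).symm)) }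

variable [IsNoetherianRing A]

/-- A graded submodule as a graded module. -/
def sub (M : GrMod 𝒜) (L : GrSub M) : GrMod 𝒜 where
  carrier := L.toSubmodule
  deg i := (M.deg i).comap (L.toSubmodule.subtype.restrictScalars k)
  isInternal := by
    refine isInternal_of_proj _
      (fun i => ((M.proj i).restrict (p := L.toSubmodule.restrictScalars k)
        (q := L.toSubmodule.restrictScalars k) (fun m hm => L.proj_mem' i m hm) :)) ?_ ?_ ?_
    · rintro i ⟨x, hx⟩ h
      exact Subtype.ext (M.proj_of_mem h)
    · rintro i j hij ⟨x, hx⟩ h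
      exact Subtype.ext (M.proj_of_mem_ne hij h)
    · rintro ⟨x, hx⟩
      obtain ⟨s, hs⟩ := M.exists_sum_proj x
      have : (⟨x, hx⟩ : L.toSubmodule) = ∑ i ∈ s, ⟨M.proj i x, L.proj_mem' i x hx⟩ := by
        apply Subtype.ext
        rw [AddSubmonoidClass.coe_finsetSum]
        exact hs
      rw [this]
      exact Submodule.sum_mem _ fun i _ => Submodule.mem_iSup_of_mem i (M.proj_mem i x)
  smul_mem ha hm := M.smul_mem ha hm

/-- The inclusion of a graded submodule. -/
def subtype (M : GrMod 𝒜) (L : GrSub M) : M.sub L ⟶ M :=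
  Hom.mk (M := M.sub L) (N := M) L.toSubmodule.subtype fun _ _ hm => hm

/-! ### The abelian category of finitely generated graded modules -/

/-- The kernel is a kernel. -/
def kerIsLimit {M N : GrMod 𝒜} (f : M ⟶ N) :
    IsLimit (KernelFork.ofι (f := f) (M.subtype (ker f))
      (hom_ext fun m => (m.2 : lin f m.1 = 0))) :=
  KernelFork.IsLimit.ofι _ _
    (fun {T} g hg => Hom.mk (M := T) (N := M.sub (ker f))
      ((lin g).codRestrict (ker f).toSubmodule fun t => LinearMap.congr_fun (congrArg lin hg) t)
      fun i t ht => g.map_deg i t ht)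
    (fun _ _ => rfl)
    (fun _ _ _ hm => hom_ext fun t => Subtype.ext (LinearMap.congr_fun (congrArg lin hm) t))

/-- The quotient by the image is a cokernel. -/
def cokerIsColimit {M N : GrMod 𝒜} (f : M ⟶ N) :
    IsColimit (CokernelCofork.ofπ (f := f) (N.mkQ (range f))
      (hom_ext fun m => (Submodule.Quotient.mk_eq_zero _).2 ⟨m, rfl⟩)) :=
  CokernelCofork.IsColimit.ofπ _ _
    (fun {T} g hg => Hom.mk (M := N.quot (range f)) (N := T)
      ((range f).toSubmodule.liftQ (lin g) (by
        rintro _ ⟨x, rfl⟩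
        exact LinearMap.congr_fun (congrArg lin hg) x))
      (by rintro i _ ⟨x, hx, rfl⟩; exact g.map_deg i x hx))
    (fun _ _ => rfl)
    (fun _ _ _ hm => hom_ext fun t => by
      obtain ⟨x, rfl⟩ := (range f).toSubmodule.mkQ_surjective t
      exact LinearMap.congr_fun (congrArg lin hm) x)

theorem injective_of_mono {M N : GrMod 𝒜} (f : M ⟶ N) [Mono f] :
    Function.Injective (lin f) := by
  rw [← LinearMap.ker_eq_bot, eq_bot_iff]
  intro m hm
  have : M.subtype (ker f) = 0 := by
    rw [← cancel_mono f, zero_comp]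
    exact hom_ext fun m => (m.2 : lin f m.1 = 0)
  exact LinearMap.congr_fun (congrArg lin this) ⟨m, hm⟩

/-- A surjective morphism is a cokernel of its kernel. -/
theorem normalEpi {M N : GrMod 𝒜} (f : M ⟶ N) (hf : Function.Surjective (lin f)) :
    Nonempty (NormalEpi f) := Nonempty.intro {
  W := M.sub (ker f)
  g := M.subtype (ker f)
  w := hom_ext fun m => (m.2 : lin f m.1 = 0)
  isColimit := by
    have key : ∀ {T : GrMod 𝒜} (g : M ⟶ T) (_ : M.subtype (ker f) ≫ g = 0) (m : M.carrier),
        lin f m = 0 → lin g m = 0 := fun g hg m hm => LinearMap.congr_fun (congrArg lin hg) ⟨m, hm⟩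
    have spec : ∀ {T : GrMod 𝒜} (g : M ⟶ T) (hg : M.subtype (ker f) ≫ g = 0) (m : M.carrier),
        ((LinearMap.ker (lin f)).liftQ (lin g) (fun m hm => key g hg m hm) ∘ₗ
          ((lin f).quotKerEquivOfSurjective hf).symm.toLinearMap) (lin f m) = lin g m := by
      intro T g hg m
      have : ((lin f).quotKerEquivOfSurjective hf).symm (lin f m) = Submodule.Quotient.mk m := by
        rw [LinearEquiv.symm_apply_eq]
        rfl
      rw [LinearMap.comp_apply, LinearEquiv.coe_coe, this]
      rfl
    exact CokernelCofork.IsColimit.ofπ _ _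
      (fun {T} g hg => Hom.mk (M := N) (N := T)
        ((LinearMap.ker (lin f)).liftQ (lin g) (fun m hm => key g hg m hm) ∘ₗ
          ((lin f).quotKerEquivOfSurjective hf).symm.toLinearMap)
        (fun i n hn => by
          obtain ⟨m, rfl⟩ := hf n
          rw [← N.proj_of_mem hn, ← lin_proj, spec g hg]
          exact g.map_deg i _ (M.proj_mem i m)))
      (fun g hg => hom_ext fun m => spec g hg m)
      (fun g hg m hm => hom_ext fun n => by
        obtain ⟨x, rfl⟩ := hf n
        exact (LinearMap.congr_fun (congrArg lin hm) x).trans (spec g hg x).symm) }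

instance : HasKernels (GrMod 𝒜) := ⟨fun f => ⟨⟨⟨_, kerIsLimit f⟩⟩⟩⟩
instance : HasCokernels (GrMod 𝒜) := ⟨fun f => ⟨⟨⟨_, cokerIsColimit f⟩⟩⟩⟩

instance : Abelian (GrMod 𝒜) where
  normalMonoOfMono f _ := normalMono f (injective_of_mono f)
  normalEpiOfEpi f _ := normalEpi f (surjective_of_epi f)

instance {k : Type uk} {A : Type uA} [Field k] [Ring A] [Algebra k A] {𝒜 : ℤ → Submodule k A}
    [IsNoetherianRing A] : HasExt.{max 1 uk uA} (GrMod 𝒜) := HasExt.standard _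

/-- `Ext^i_A(M, N)_d = Ext^i_{A-gmod}(M, N⟨-d⟩)`. -/
abbrev GExt (M N : GrMod 𝒜) (i : ℕ) (d : ℤ) : Type _ := Abelian.Ext M (N.shift (-d)) i

/-! ### Filtrations -/

/-- A filtration `M = M⁰ ⊇ M¹ ⊇ M² ⊇ ⋯` by graded submodules. -/
structure Filtration (M : GrMod 𝒜) where
  step : ℕ → GrSub M
  step_zero : (step 0).toSubmodule = ⊤
  step_succ_le : ∀ i, (step (i + 1)).toSubmodule ≤ (step i).toSubmodule

namespace Filtration

variable {M : GrMod 𝒜} {α : Type*}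

/-- The factor `Mⁱ / Mⁱ⁺¹`. -/
def factor (Φ : Filtration M) (i : ℕ) : GrMod 𝒜 :=
  (M.sub (Φ.step i)).quot ((Φ.step (i + 1)).comap (M.subtype (Φ.step i)))

/-- `Φ` is an `F`-filtration: it is separable, and each of its factors is zero or isomorphic to a
shift of a member of the family `F`. -/
structure IsFiltrationBy (Φ : Filtration M) (F : α → GrMod 𝒜) : Prop where
  separable : ⨅ i, (Φ.step i).toSubmodule = ⊥
  factor_iso : ∀ i, IsZero (Φ.factor i) ∨ ∃ a d, Nonempty (Φ.factor i ≅ (F a).shift d)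

/-- The number of factors isomorphic to `X`. -/
def multiplicity (Φ : Filtration M) (X : GrMod 𝒜) : ℕ∞ :=
  {i : ℕ | Nonempty (Φ.factor i ≅ X)}.encard

end Filtration

/-- `M` is filtered by the family `F`. -/
def IsFilteredBy {α : Type*} (M : GrMod 𝒜) (F : α → GrMod 𝒜) : Prop :=
  ∃ Φ : Filtration M, Φ.IsFiltrationBy F

/-- `M` has an `F`-filtration in which, for all `a` and `d`, the number of factors isomorphic to
`F a ⟨d⟩` is `f a d`. -/
def IsFilteredWithMultiplicity {α : Type*} (M : GrMod 𝒜) (F : α → GrMod 𝒜) (f : α → ℤ → ℕ) :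
    Prop :=
  ∃ Φ : Filtration M, Φ.IsFiltrationBy F ∧ ∀ a d, Φ.multiplicity ((F a).shift d) = f a d

end GrMod

/-! ## The skew group algebra -/

/-- The polynomial ring `S = ℂ[X₁, …, Xₙ]`. -/
abbrev PolyRing (n : ℕ) : Type := MvPolynomial (Fin n) ℂ

/-- The homogeneous part of degree `i` of `S`, for an integer `i`. -/
def polyDeg (n : ℕ) : ℤ → Submodule ℂ (PolyRing n)
  | Int.ofNat d => MvPolynomial.homogeneousSubmodule (Fin n) ℂ d
  | Int.negSucc _ => ⊥

/-- The projection of `S` to its homogeneous part of degree `i`. -/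
def polyProj (n : ℕ) : ℤ → PolyRing n →ₗ[ℂ] PolyRing n
  | Int.ofNat d => MvPolynomial.homogeneousComponent d
  | Int.negSucc _ => 0

theorem polyProj_of_mem {n : ℕ} : ∀ (i : ℤ), ∀ p ∈ polyDeg n i, polyProj n i p = p
  | Int.ofNat d, p, hp => by
    have := MvPolynomial.homogeneousComponent_of_mem (m := d) hp
    simpa [polyProj] using this
  | Int.negSucc _, p, hp => by
    rw [(Submodule.mem_bot ℂ).1 hp, map_zero]

theorem polyProj_of_mem_ne {n : ℕ} :
    ∀ (i j : ℤ), i ≠ j → ∀ p ∈ polyDeg n i, polyProj n j p = 0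
  | Int.ofNat d, Int.ofNat e, h, p, hp => by
    have := MvPolynomial.homogeneousComponent_of_mem (m := e) hp
    rw [if_neg (by rintro rfl; exact h rfl)] at this
    exact this
  | Int.negSucc _, _, _, p, hp => by
    rw [(Submodule.mem_bot ℂ).1 hp, map_zero]
  | Int.ofNat _, Int.negSucc _, _, _, _ => rfl

theorem mem_iSup_polyDeg {n : ℕ} (p : PolyRing n) : p ∈ ⨆ i, polyDeg n i := by
  rw [← MvPolynomial.sum_homogeneousComponent p]
  exact Submodule.sum_mem _ fun d _ => Submodule.mem_iSup_of_mem (d : ℤ)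
    (MvPolynomial.homogeneousComponent_isHomogeneous d p)

theorem polyDeg_mul {n : ℕ} : ∀ {i j : ℤ} {p q : PolyRing n},
    p ∈ polyDeg n i → q ∈ polyDeg n j → p * q ∈ polyDeg n (i + j)
  | Int.ofNat _, Int.ofNat _, _, _, hp, hq => MvPolynomial.IsHomogeneous.mul hp hq
  | Int.negSucc _, _, _, _, hp, _ => by
    rw [(Submodule.mem_bot ℂ).1 hp, zero_mul]
    exact Submodule.zero_mem _
  | Int.ofNat _, Int.negSucc _, _, _, _, hq => by
    rw [(Submodule.mem_bot ℂ).1 hq, mul_zero]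
    exact Submodule.zero_mem _

section skew

variable (W : Type uA) [Group W] (n : ℕ) [MulSemiringAction W (PolyRing n)]

/-- The action of `W` on `S` preserves the grading. -/
class PreservesDegree : Prop where
  isHomogeneous_smul : ∀ (w : W) (p : PolyRing n) (d : ℕ), p.IsHomogeneous d →
    (w • p).IsHomogeneous d

/-- The ideal `S · R_{>0}` of `S` generated by the homogeneous invariants of positive degree. -/
def invariantIdeal : Ideal (PolyRing n) :=
  Ideal.span {p | (∀ w : W, w • p = p) ∧ ∃ d > 0, p.IsHomogeneous d}

/-- The skew group algebra `A = S * W`; the element `s ⊗ w` is `SkewMonoidAlgebra.single w s`. -/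
abbrev SkewAlg : Type uA := SkewMonoidAlgebra (PolyRing n) W

instance [Finite W] : IsNoetherianRing (SkewAlg W n) := by
  let e : SkewAlg W n ≃ₗ[PolyRing n] (W →₀ PolyRing n) :=
    { SkewMonoidAlgebra.coeffAddEquiv with map_smul' := fun _ _ => rfl }
  have : IsNoetherian (PolyRing n) (SkewAlg W n) := isNoetherian_of_linearEquiv e.symm
  exact isNoetherian_of_tower (PolyRing n) this

/-- The homogeneous part `S_i ⊗ ℂW` of degree `i` of `S * W`. -/
def skewDeg (i : ℤ) : Submodule ℂ (SkewAlg W n) where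
  carrier := {a | ∀ w, a.coeff w ∈ polyDeg n i}
  add_mem' ha hb w := by
    rw [SkewMonoidAlgebra.coeff_add]
    exact Submodule.add_mem _ (ha w) (hb w)
  zero_mem' w := Submodule.zero_mem _
  smul_mem' c a ha w := Submodule.smul_mem _ c (ha w)

variable {W n}

theorem single_mem_skewDeg {W : Type uA} {n : ℕ} {i : ℤ} {s : PolyRing n} (w : W) (hs : s ∈ polyDeg n i) :
    SkewMonoidAlgebra.single w s ∈ skewDeg W n i := by
  classical
  intro v
  rw [SkewMonoidAlgebra.coeff_single_apply]
  split_ifs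
  · exact hs
  · exact Submodule.zero_mem _

theorem smul_mem_polyDeg [PreservesDegree W n] (w : W) : ∀ {i : ℤ} {p : PolyRing n},
    p ∈ polyDeg n i → w • p ∈ polyDeg n i
  | Int.ofNat d, p, hp => PreservesDegree.isHomogeneous_smul w p d hp
  | Int.negSucc _, p, hp => by
    rw [(Submodule.mem_bot ℂ).1 hp, smul_zero]
    exact Submodule.zero_mem _

/-- It suffices to check compatibility with the gradings on the elements `s ⊗ w`. -/
theorem smul_mem_of_single {M : Type*} [AddCommGroup M] [Module ℂ M] [Module (SkewAlg W n) M]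
    (deg : ℤ → Submodule ℂ M)
    (h : ∀ (w : W) (i j : ℤ) (s : PolyRing n) (m : M), s ∈ polyDeg n i → m ∈ deg j →
      SkewMonoidAlgebra.single w s • m ∈ deg (i + j))
    {i j : ℤ} {a : SkewAlg W n} {m : M} (ha : a ∈ skewDeg W n i) (hm : m ∈ deg j) :
    a • m ∈ deg (i + j) := by
  rw [← SkewMonoidAlgebra.sum_single a, SkewMonoidAlgebra.sum_def', Finset.sum_smul]
  exact Submodule.sum_mem _ fun w _ => h w i j _ m (ha w) hm

variable [SMulCommClass W ℂ (PolyRing n)]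

variable (W n) in
/-- Finitely generated graded `S * W`-modules. -/
abbrev SkewMod := GrMod (skewDeg W n)

/-! ### The modules `P_V = S ⊗ V` -/

section proj

variable {V : Type} [AddCommGroup V] [Module ℂ V] (ρ : Representation ℂ W V)

/-- The action `(s ⊗ w)(p ⊗ v) = s w(p) ⊗ w(v)` of `S * W` on `S ⊗ V`. -/
def projAction : SkewAlg W n →ₐ[ℂ] Module.End ℂ (PolyRing n ⊗[ℂ] V) :=
  SkewMonoidAlgebra.liftNCAlgHom (Algebra.lsmul ℂ ℂ (PolyRing n ⊗[ℂ] V))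
    ((Representation.ofDistribMulAction ℂ W (PolyRing n)).tprod ρ) (by
      intro s w
      refine TensorProduct.ext' fun p v => ?_
      simp [TensorProduct.smul_tmul', smul_mul'])

theorem projAction_single (w : W) (s p : PolyRing n) (v : V) :
    projAction ρ (SkewMonoidAlgebra.single w s) (p ⊗ₜ v) = (s * w • p) ⊗ₜ ρ w v := by
  simp [projAction, SkewMonoidAlgebra.liftNCAlgHom, SkewMonoidAlgebra.liftNCRingHom,
    TensorProduct.smul_tmul']

/-- The homogeneous part `S_i ⊗ V` of `S ⊗ V`. -/
def tensorDeg (n : ℕ) (V : Type) [AddCommGroup V] [Module ℂ V] (i : ℤ) :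
    Submodule ℂ (PolyRing n ⊗[ℂ] V) :=
  LinearMap.range (LinearMap.rTensor V (polyDeg n i).subtype)

theorem tmul_mem_tensorDeg {i : ℤ} {p : PolyRing n} (hp : p ∈ polyDeg n i) (v : V) :
    p ⊗ₜ v ∈ tensorDeg n V i :=
  ⟨(⟨p, hp⟩ : polyDeg n i) ⊗ₜ v, rfl⟩

theorem tensorDeg_le {i : ℤ} {N : Submodule ℂ (PolyRing n ⊗[ℂ] V)}
    (h : ∀ p ∈ polyDeg n i, ∀ v : V, p ⊗ₜ v ∈ N) : tensorDeg n V i ≤ N := by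
  rintro _ ⟨x, rfl⟩
  induction x using TensorProduct.induction_on with
  | zero => simp
  | tmul p v => exact h p p.2 v
  | add x y hx hy => rw [map_add]; exact Submodule.add_mem _ hx hy

variable [FiniteDimensional ℂ V] [PreservesDegree W n]

/-- The graded `S * W`-module `P_V = S ⊗ V`. -/
def projModule : SkewMod W n :=
  letI : Module (SkewAlg W n) (PolyRing n ⊗[ℂ] V) :=
    Module.compHom _ (projAction (n := n) ρ).toRingHom
  haveI : IsScalarTower ℂ (SkewAlg W n) (PolyRing n ⊗[ℂ] V) :=
    ⟨fun c a m => LinearMap.congr_fun (map_smul (projAction ρ) c a) m⟩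
  { carrier := PolyRing n ⊗[ℂ] V
    finite := by
      have hs : ∀ (w : W) (s p : PolyRing n) (v : V),
          (SkewMonoidAlgebra.single w s : SkewAlg W n) • (p ⊗ₜ[ℂ] v) = (s * w • p) ⊗ₜ ρ w v :=
        projAction_single ρ
      let b := Module.finBasis ℂ V
      refine ⟨Submodule.fg_def.2 ⟨Set.range fun i => (1 : PolyRing n) ⊗ₜ[ℂ] b i,
        Set.finite_range _, ?_⟩⟩
      rw [eq_top_iff]
      rintro x -
      induction x using TensorProduct.induction_on with
      | zero => exact Submodule.zero_mem _
      | add x y hx hy => exact Submodule.add_mem _ hx hy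
      | tmul p v =>
        rw [← b.sum_repr v, TensorProduct.tmul_sum]
        refine Submodule.sum_mem _ fun i _ => ?_
        have : p ⊗ₜ[ℂ] (b.repr v i • b i) =
            (SkewMonoidAlgebra.single 1 (b.repr v i • p) : SkewAlg W n) •
              ((1 : PolyRing n) ⊗ₜ[ℂ] b i) := by
          rw [hs]
          simp [TensorProduct.tmul_smul, TensorProduct.smul_tmul']
        rw [this]
        exact Submodule.smul_mem _ _ (Submodule.subset_span ⟨i, rfl⟩)
    deg := tensorDeg n V
    isInternal := by
      refine GrMod.isInternal_of_proj _ (fun i => LinearMap.rTensor V (polyProj n i)) ?_ ?_ ?_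
      · intro i
        refine tensorDeg_le (N := LinearMap.eqLocus _ LinearMap.id) fun p hp v => ?_
        simp [polyProj_of_mem i p hp]
      · intro i j hij
        refine tensorDeg_le (N := LinearMap.ker _) fun p hp v => ?_
        simp [polyProj_of_mem_ne i j hij p hp]
      · intro m
        induction m using TensorProduct.induction_on with
        | zero => exact Submodule.zero_mem _
        | add x y hx hy => exact Submodule.add_mem _ hx hy
        | tmul p v =>
          have : (⨆ i, polyDeg n i) ≤
              (⨆ i, tensorDeg n V i).comap ((TensorProduct.mk ℂ (PolyRing n) V).flip v) :=
            iSup_le fun i q hq => Submodule.mem_iSup_of_mem i (tmul_mem_tensorDeg hq v)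
          exact this (mem_iSup_polyDeg p)
    smul_mem := by
      refine smul_mem_of_single _ fun w i j s m hs hm => ?_
      have : tensorDeg n V j ≤
          (tensorDeg n V (i + j)).comap (projAction ρ (SkewMonoidAlgebra.single w s)) :=
        tensorDeg_le fun p hp v => by
          rw [Submodule.mem_comap, projAction_single]
          exact tmul_mem_tensorDeg (polyDeg_mul hs (smul_mem_polyDeg w hp)) _
      exact this hm }

end proj

/-! ### Duals of finite-dimensional modules -/

variable (W n) in
/-- The anti-automorphism `s ⊗ w ↦ w⁻¹(s) ⊗ w⁻¹` of `S * W`. -/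
def skewOp : SkewAlg W n →ₐ[ℂ] (SkewAlg W n)ᵐᵒᵖ :=
  SkewMonoidAlgebra.liftNCAlgHom
    (AlgHom.mk (R := ℂ) (A := PolyRing n) (B := (SkewAlg W n)ᵐᵒᵖ)
      (SkewMonoidAlgebra.singleOneRingHom.toOpposite fun x y => by
        change _ * _ = _ * _
        rw [← map_mul, ← map_mul, mul_comm]) (fun _ => rfl))
    { toFun := fun w => MulOpposite.op (SkewMonoidAlgebra.single w⁻¹ 1)
      map_one' := by rw [inv_one, SkewMonoidAlgebra.single_one_one, MulOpposite.op_one]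
      map_mul' := fun v w => by
        rw [← MulOpposite.op_mul, SkewMonoidAlgebra.single_mul_single]
        simp }
    (by
      intro s w
      change MulOpposite.op (SkewMonoidAlgebra.single 1 (w • s)) * MulOpposite.op _ =
        MulOpposite.op _ * MulOpposite.op (SkewMonoidAlgebra.single 1 s)
      rw [← MulOpposite.op_mul, ← MulOpposite.op_mul, SkewMonoidAlgebra.single_mul_single,
        SkewMonoidAlgebra.single_mul_single]
      simp)

theorem skewOp_single (w : W) (s : PolyRing n) :
    (skewOp W n (SkewMonoidAlgebra.single w s)).unop = SkewMonoidAlgebra.single w⁻¹ (w⁻¹ • s) := by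
  have : skewOp W n (SkewMonoidAlgebra.single w s) =
      MulOpposite.op (SkewMonoidAlgebra.single 1 s) *
        MulOpposite.op (SkewMonoidAlgebra.single w⁻¹ 1) := by
    simp only [skewOp, SkewMonoidAlgebra.liftNCAlgHom, SkewMonoidAlgebra.liftNCRingHom]
    exact SkewMonoidAlgebra.liftNC_single _ _ _ _
  rw [this, ← MulOpposite.op_mul, SkewMonoidAlgebra.single_mul_single]
  simp

/-- The part of degree `i` of `Hom_ℂ(M, ℂ)`, which is `Hom_ℂ(M_{-i}, ℂ)`: the functionals that
vanish on `M_j` for `j ≠ -i`. -/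
def dualDeg (M : SkewMod W n) (i : ℤ) : Submodule ℂ (Module.Dual ℂ M.carrier) where
  carrier := {f | ∀ j, j ≠ -i → ∀ m ∈ M.deg j, f m = 0}
  add_mem' hf hg j hj m hm := by simp [hf j hj m hm, hg j hj m hm]
  zero_mem' _ _ _ _ := rfl
  smul_mem' c f hf j hj m hm := by simp [hf j hj m hm]

/-- The dual `M^* = Hom_ℂ(M, ℂ)` of a finite-dimensional graded `S * W`-module, with the action
`((s ⊗ w) f)(m) = f((w⁻¹(s) ⊗ w⁻¹) m)`. -/
def dualModule [PreservesDegree W n] (M : SkewMod W n) [FiniteDimensional ℂ M.carrier] : SkewMod W n :=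
  letI : Module (SkewAlg W n) (Module.Dual ℂ M.carrier) :=
    { smul := fun a f => f ∘ₗ Algebra.lsmul ℂ ℂ M.carrier (skewOp W n a).unop
      one_smul := fun f => by ext m; change f _ = _; simp
      mul_smul := fun a b f => by ext m; change f _ = f _; simp
      smul_zero := fun a => rfl
      smul_add := fun a f g => rfl
      add_smul := fun a b f => by ext m; change f _ = f _ + f _; simp
      zero_smul := fun f => by ext m; change f _ = _; simp }
  haveI : IsScalarTower ℂ (SkewAlg W n) (Module.Dual ℂ M.carrier) :=
    ⟨fun c a f => by
      ext m
      change f ((skewOp W n (c • a)).unop • m) = c • f ((skewOp W n a).unop • m)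
      rw [map_smul (skewOp W n), MulOpposite.unop_smul, smul_assoc, map_smul f]⟩
  { carrier := Module.Dual ℂ M.carrier
    finite := Module.Finite.of_restrictScalars_finite ℂ _ _
    deg := dualDeg M
    isInternal := by
      refine GrMod.isInternal_of_proj _
        (fun i => (M.proj (-i)).dualMap) ?_ ?_ ?_
      · intro i f hf
        refine M.ext_deg fun j m hm => ?_
        by_cases h : j = -i
        · subst h
          simp [M.proj_of_mem hm]
        · simp [M.proj_of_mem_ne h hm, hf j h m hm]
      · intro i j hij f hf
        refine M.ext_deg fun l m hm => ?_
        by_cases h : l = -j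
        · subst h
          simpa [M.proj_of_mem hm] using hf (-j) (by omega) m hm
        · simp [M.proj_of_mem_ne h hm]
      · intro f
        have hfin : {i | M.deg i ≠ ⊥}.Finite :=
          WellFoundedGT.finite_ne_bot_of_iSupIndep M.isInternal.submodule_iSupIndep
        have hf : f = ∑ i ∈ hfin.toFinset, (M.proj i).dualMap f := by
          refine M.ext_deg fun j m hm => ?_
          rw [LinearMap.sum_apply]
          by_cases h : M.deg j = ⊥
          · rw [h, Submodule.mem_bot] at hm
            simp [hm]
          · rw [Finset.sum_eq_single j]
            · simp [M.proj_of_mem hm]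
            · intro i _ hij
              simp [M.proj_of_mem_ne hij.symm hm]
            · intro h'
              exact absurd (hfin.mem_toFinset.2 h) h'
        rw [hf]
        refine Submodule.sum_mem _ fun i _ => Submodule.mem_iSup_of_mem (-i) ?_
        intro j hj m hm
        simp [M.proj_of_mem_ne (by simpa using hj) hm]
    smul_mem := by
      refine smul_mem_of_single _ fun w i j s f hs hf l hl m hm => ?_
      change f ((skewOp W n (SkewMonoidAlgebra.single w s)).unop • m) = 0
      rw [skewOp_single]
      exact hf _ (by omega) _
        (M.smul_mem (single_mem_skewDeg w⁻¹ (smul_mem_polyDeg w⁻¹ hs)) hm) }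

theorem mul_rTensor_smul {V : Type} [AddCommGroup V] [Module ℂ V] (ρ : Representation ℂ W V)
    {r : PolyRing n} (hr : ∀ w : W, w • r = r) (a : SkewAlg W n) (x : PolyRing n ⊗[ℂ] V) :
    LinearMap.rTensor V (LinearMap.mulLeft ℂ r) (projAction ρ a x) =
      projAction ρ a (LinearMap.rTensor V (LinearMap.mulLeft ℂ r) x) := by
  induction a using SkewMonoidAlgebra.induction_on' with
  | single w s =>
    induction x using TensorProduct.induction_on with
    | zero => simp
    | add x y hx hy => simp only [map_add, hx, hy]
    | tmul p v =>
      rw [projAction_single, LinearMap.rTensor_tmul, LinearMap.rTensor_tmul, projAction_single]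
      simp only [LinearMap.mulLeft_apply, smul_mul', hr]
      congr 1
      ring
  | add a b ha hb => simp only [map_add, LinearMap.add_apply, ha, hb]

/-! ## Irreducible representations and trace quotient modules -/

variable (W) in
/-- An irreducible finite-dimensional complex representation of `W`. -/
structure Irrep where
  V : Type
  [addCommGroup : AddCommGroup V]
  [module : Module ℂ V]
  [finite : FiniteDimensional ℂ V]
  ρ : Representation ℂ W V
  irreducible : ρ.IsIrreducible

attribute [instance] Irrep.addCommGroup Irrep.module Irrep.finite

instance Irrep.setoid (W : Type uA) [Group W] : Setoid (Irrep W) where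
  r σ τ := Nonempty (σ.ρ.Equiv τ.ρ)
  iseqv := ⟨fun _ => ⟨.refl _⟩, fun ⟨e⟩ => ⟨e.symm⟩, fun ⟨e⟩ ⟨f⟩ => ⟨e.trans f⟩⟩

variable (W) in
/-- The set `Irr W` of isomorphism classes of irreducible complex representations of `W`. -/
def Irr : Type _ := Quotient (Irrep.setoid W)

/-- A representative of an isomorphism class. -/
def Irr.rep (l : Irr W) : Irrep W := Quotient.out l

variable [PreservesDegree W n]

variable (n) in
/-- The projective module `P_λ = S ⊗ λ`. -/
def PMod (l : Irr W) : SkewMod W n := projModule l.rep.ρ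

variable (n) in
/-- The sum of the images of all homogeneous homomorphisms `P_μ → P_λ` of positive degree, where
`μ` runs over the set `T`. -/
def traceSub (T : Set (Irr W)) (l : Irr W) : GrMod.GrSub (PMod n l) :=
  GrMod.GrSub.iSup fun x : Σ m : T, Σ d : {d : ℤ // 0 < d},
    ((PMod n m.1).shift d.1 ⟶ PMod n l) => GrMod.range x.2.2

variable (n) in
/-- The trace quotient module `K_λ = P_λ / I_λ`. -/
def KMod [Preorder (Irr W)] (l : Irr W) : SkewMod W n :=
  (PMod n l).quot (traceSub n {m | l ≤ m} l)

variable (n) in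
/-- The strict trace quotient module `K̃_λ = P_λ / Ĩ_λ`. -/
def KtMod [Preorder (Irr W)] (l : Irr W) : SkewMod W n :=
  (PMod n l).quot (traceSub n {m | l < m} l)

/-- The coefficient of `q^d` in `[M : L_λ]_q`: the multiplicity `[M_d : λ]` of `λ` in the
`W`-representation `M_d`, that is, the dimension of `Hom_W(λ, M_d)`. -/
def gradedMult (M : SkewMod W n) (l : Irr W) (d : ℤ) : ℕ :=
  Module.finrank ℂ
    ({ carrier := {f | (∀ v, f v ∈ M.deg d) ∧
          ∀ (w : W) v, f (l.rep.ρ w v) = (SkewMonoidAlgebra.single w 1 : SkewAlg W n) • f v}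
       add_mem' := fun hf hg => ⟨fun v => Submodule.add_mem _ (hf.1 v) (hg.1 v),
          fun w v => by simp [hf.2, hg.2]⟩
       zero_mem' := ⟨fun v => Submodule.zero_mem _, fun w v => by simp⟩
       smul_mem' := fun c f hf => ⟨fun v => Submodule.smul_mem _ c (hf.1 v),
          fun w v => by
            rw [LinearMap.smul_apply, LinearMap.smul_apply, hf.2, smul_comm]⟩ } :
      Submodule ℂ (l.rep.V →ₗ[ℂ] M.carrier))

/-! ### Finite-dimensionality of the trace quotient modules -/

/-- Multiplication by a homogeneous invariant of degree `d`, as a homomorphism of degree `d`. -/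
def mulInvariant (l : Irr W) {r : PolyRing n} (hr : ∀ w : W, w • r = r) {d : ℕ}
    (hd : r.IsHomogeneous d) : (PMod n l).shift d ⟶ PMod n l :=
  GrMod.Hom.mk (M := (PMod n l).shift d) (N := PMod n l)
    { toFun := LinearMap.rTensor l.rep.V (LinearMap.mulLeft ℂ r)
      map_add' := fun x y => map_add _ x y
      map_smul' := fun a x => mul_rTensor_smul l.rep.ρ hr a x }
    (by
      intro i m hm
      have : tensorDeg n l.rep.V (i - d) ≤ (tensorDeg n l.rep.V i).comap
          (LinearMap.rTensor l.rep.V (LinearMap.mulLeft ℂ r)) :=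
        tensorDeg_le fun p hp v => by
          rw [Submodule.mem_comap, LinearMap.rTensor_tmul]
          have := polyDeg_mul (i := (d : ℤ)) (show r ∈ polyDeg n d from hd) hp
          rw [add_sub_cancel] at this
          exact tmul_mem_tensorDeg this v
      exact this hm)

theorem tmul_mem_traceSub {T : Set (Irr W)} {l : Irr W} (hl : l ∈ T) {p : PolyRing n}
    (hp : p ∈ invariantIdeal W n) (v : l.rep.V) :
    (show (PMod n l).carrier from (p ⊗ₜ[ℂ] v : PolyRing n ⊗[ℂ] l.rep.V)) ∈
      (traceSub n T l).toSubmodule := by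
  induction hp using Submodule.span_induction with
  | zero => rw [TensorProduct.zero_tmul]; exact Submodule.zero_mem _
  | add x y _ _ hx hy => rw [TensorProduct.add_tmul]; exact Submodule.add_mem _ hx hy
  | mem r hr =>
    obtain ⟨hr, d, hd, hrd⟩ := hr
    refine Submodule.mem_iSup_of_mem
      (⟨⟨l, hl⟩, ⟨(d : ℤ), by exact_mod_cast hd⟩, mulInvariant l hr hrd⟩ :
        Σ m : T, Σ d : {d : ℤ // 0 < d}, ((PMod n m.1).shift d.1 ⟶ PMod n l)) ?_
    refine ⟨((1 : PolyRing n) ⊗ₜ[ℂ] v : PolyRing n ⊗[ℂ] l.rep.V), ?_⟩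
    exact (LinearMap.rTensor_tmul _ _ _ _).trans (by rw [LinearMap.mulLeft_apply, mul_one])
  | smul a x _ hx =>
    have h := (traceSub n T l).toSubmodule.smul_mem (SkewMonoidAlgebra.single 1 a) hx
    have e : projAction l.rep.ρ (SkewMonoidAlgebra.single 1 a) (x ⊗ₜ[ℂ] v) = (a • x) ⊗ₜ[ℂ] v := by
      rw [projAction_single]
      simp
    rw [← e]
    exact h

theorem finite_quotient_tensor {V : Type} [AddCommGroup V] [Module ℂ V] [FiniteDimensional ℂ V]
    (I : Ideal (PolyRing n)) [FiniteDimensional ℂ (PolyRing n ⧸ I)]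
    (N : Submodule ℂ (PolyRing n ⊗[ℂ] V)) (h : ∀ p ∈ I, ∀ v : V, p ⊗ₜ[ℂ] v ∈ N) :
    FiniteDimensional ℂ ((PolyRing n ⊗[ℂ] V) ⧸ N) := by
  let f : (PolyRing n ⧸ I) →ₗ[ℂ] V →ₗ[ℂ] ((PolyRing n ⊗[ℂ] V) ⧸ N) :=
    (I.restrictScalars ℂ).liftQ ((TensorProduct.mk ℂ (PolyRing n) V).compr₂ N.mkQ) fun p hp => by
      ext v
      exact (Submodule.Quotient.mk_eq_zero _).2 (h p hp v)
  refine Module.Finite.of_surjective (TensorProduct.lift f) fun x => ?_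
  obtain ⟨x, rfl⟩ := N.mkQ_surjective x
  induction x using TensorProduct.induction_on with
  | zero => exact ⟨0, by simp⟩
  | tmul p v => exact ⟨Ideal.Quotient.mk I p ⊗ₜ v, rfl⟩
  | add x y hx hy =>
    obtain ⟨a, ha⟩ := hx
    obtain ⟨b, hb⟩ := hy
    exact ⟨a + b, by rw [map_add, ha, hb, map_add]⟩

instance [Preorder (Irr W)] [FiniteDimensional ℂ (PolyRing n ⧸ invariantIdeal W n)] (l : Irr W) :
    FiniteDimensional ℂ (KMod n l).carrier := by
  let N : Submodule ℂ (PMod n l).carrier :=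
    (traceSub n {m | l ≤ m} l).toSubmodule.restrictScalars ℂ
  have : FiniteDimensional ℂ ((PMod n l).carrier ⧸ N) :=
    finite_quotient_tensor (V := l.rep.V) (invariantIdeal W n) N
      fun p hp v => tmul_mem_traceSub (le_refl l) hp v
  exact Module.Finite.equiv (Submodule.Quotient.restrictScalarsEquiv ℂ
    (traceSub n {m | l ≤ m} l).toSubmodule)

end skew

end

/-! Write `N_l` for the kernel of `P_l → K̃_l`, and `D = K_m^*⟨e⟩` with `e = -d`. Three facts drive
the proof. Homomorphisms `P_l⟨d⟩ → M` are the equivariant maps `l → M_d`, so by averaging over `W`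
these modules are projective, and self-duality gives `dim Hom(P_l, D) = [K_m : L_l]_e`. The module
`K_m` is generated by its degree-zero part `m`, so `D` lives in degrees at most `e` and its socle is
`m` in degree `e`. The module `N_l` lives in degrees at least `1`.

For `e ≤ 0` all `Hom` and `Ext` from `N_l` to `D` vanish by degrees, so `Ext^{>0}(K̃_l, D) = 0`, and
`Hom(K̃_l, D) = Hom(P_l, D)` has dimension `[K_m : L_l]_e`, which is `1` for `e = 0`, `l = m` and
`0` otherwise.

For `e > 0` one argues by strong induction on `e`. The first nonzero factor of the filtration of
`P_l` is necessarily `K̃_l`, so what remains filters `N_l` by factors `K̃_a⟨d⟩` with `d > 0`. Since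
`Ext(K̃_a⟨d⟩, K_m^*⟨e⟩) = Ext(K̃_a, K_m^*⟨e-d⟩)`, these factors are governed by smaller degrees:
they have no higher `Ext` to `D`, and only `K̃_m⟨e⟩` has a nonzero `Hom`, of dimension one. Three
things follow in turn (`orthogonal`).

Order: if `[K_m : L_l]_e ≠ 0`, then `K̃_m⟨e⟩` occurs in `N_l`, and its map to `D` extends to a
nonzero map `N_l → D`. As `N_l` is a sum of images of `P_a⟨d⟩` with `l < a` and `d > 0`, some such
`P_a⟨d⟩` maps nontrivially to `D`, whence `a = m` or, by induction, `a < m`. In both cases `l < m`.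

`Hom`: a nonzero map `K̃_l → D` forces `l < m`, and its image contains the socle, which lifts to a
nonzero `P_m⟨e⟩ → K̃_l`. The definition of `K̃_l` excludes this.

`Ext`: restriction `Hom(P_l, D) → Hom(N_l, D)` is now injective. The target has dimension at most
the number of factors `K̃_m⟨e⟩`, which by the multiplicity hypothesis is `[K_m : L_l]_e`, the
dimension of the source. So restriction is onto and `Ext^1` vanishes. Higher `Ext` reduces to `N_l`
by dimension shifting. -/

noncomputable section

/-! ## Ext groups and short exact sequences -/

namespace CategoryTheory.Abelian.Ext

universe w v u

variable {C : Type u} [Category.{v} C] [Abelian C] [HasExt.{w} C] {S : ShortComplex C}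

theorem subsingleton_middle (hS : S.ShortExact) (Y : C) (i : ℕ)
    (h₁ : Subsingleton (Ext S.X₁ Y i)) (h₃ : Subsingleton (Ext S.X₃ Y i)) :
    Subsingleton (Ext S.X₂ Y i) := by
  refine subsingleton_of_forall_eq 0 fun x => ?_
  obtain ⟨y, rfl⟩ := contravariant_sequence_exact₂ hS Y x (Subsingleton.elim _ _)
  rw [Subsingleton.elim y 0, comp_zero]

/-- Dimension shifting along a projective middle term. -/
theorem subsingleton_right (hS : S.ShortExact) [Projective S.X₂] (Y : C) (i : ℕ)
    (h₁ : Subsingleton (Ext S.X₁ Y i)) : Subsingleton (Ext S.X₃ Y (i + 1)) := by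
  refine subsingleton_of_forall_eq 0 fun x => ?_
  obtain ⟨y, rfl⟩ := contravariant_sequence_exact₃ hS Y x (eq_zero_of_projective _)
    (add_comm 1 i)
  rw [Subsingleton.elim y 0, comp_zero]

/-- Since the middle term is projective, every class in `Ext¹` is the image of a map on `S.X₁` under
the connecting homomorphism, which kills restrictions of maps on `S.X₂`. -/
theorem subsingleton_one_of_extension (hS : S.ShortExact) [Projective S.X₂] (Y : C)
    (h : ∀ f : S.X₁ ⟶ Y, ∃ g : S.X₂ ⟶ Y, S.f ≫ g = f) : Subsingleton (Ext S.X₃ Y 1) := by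
  refine subsingleton_of_forall_eq 0 fun x => ?_
  obtain ⟨y, rfl⟩ := contravariant_sequence_exact₃ hS Y x (eq_zero_of_projective _)
    (add_zero 1)
  obtain ⟨f, rfl⟩ := addEquiv₀.symm.surjective y
  obtain ⟨g, rfl⟩ := h f
  rw [addEquiv₀_symm_apply, ← mk₀_comp_mk₀, hS.extClass_comp_assoc]

/-- The obstruction to extending `f` is its image in `Ext¹` of the quotient. -/
theorem exists_extension (hS : S.ShortExact) (Y : C) (h : Subsingleton (Ext S.X₃ Y 1))
    (f : S.X₁ ⟶ Y) : ∃ g : S.X₂ ⟶ Y, S.f ≫ g = f := by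
  obtain ⟨x, hx⟩ := contravariant_sequence_exact₁ hS Y (mk₀ f) (add_zero 1)
    (Subsingleton.elim _ _)
  obtain ⟨g, rfl⟩ := addEquiv₀.symm.surjective x
  refine ⟨g, ?_⟩
  rw [addEquiv₀_symm_apply, mk₀_comp_mk₀] at hx
  exact addEquiv₀.symm.injective (by simpa using hx)

theorem subsingleton_of_iso {X X' Y Y' : C} (e : X ≅ X') (e' : Y ≅ Y') (i : ℕ)
    (h : Subsingleton (Ext X Y i)) : Subsingleton (Ext X' Y' i) := by
  refine subsingleton_of_forall_eq 0 fun x => ?_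
  have : (mk₀ e.hom).comp (x.comp (mk₀ e'.inv) (add_zero i)) (zero_add i) = 0 :=
    Subsingleton.elim _ _
  have h' : (mk₀ e.inv).comp ((mk₀ e.hom).comp (x.comp (mk₀ e'.inv) (add_zero i)) (zero_add i))
      (zero_add i) = 0 := by rw [this, comp_zero]
  rw [mk₀_comp_mk₀_assoc, e.inv_hom_id, mk₀_id_comp] at h'
  have h'' := congrArg (fun z => Ext.comp z (mk₀ e'.hom) (add_zero i)) h'
  simpa using h''

end CategoryTheory.Abelian.Ext

/-! ## Graded modules -/

namespace GrMod

variable {k : Type uk} {A : Type uA} [Field k] [Ring A] [Algebra k A] {𝒜 : ℤ → Submodule k A}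

theorem mono_of_injective {M N : GrMod 𝒜} (f : M ⟶ N) (hf : Function.Injective (lin f)) :
    Mono f :=
  ⟨fun _ _ h => hom_ext fun t => hf (LinearMap.congr_fun (congrArg lin h) t)⟩

theorem epi_of_surjective {M N : GrMod 𝒜} (f : M ⟶ N) (hf : Function.Surjective (lin f)) :
    Epi f :=
  ⟨fun _ _ h => hom_ext fun n => by
    obtain ⟨m, rfl⟩ := hf n
    exact LinearMap.congr_fun (congrArg lin h) m⟩

theorem mkQ_surjective (M : GrMod 𝒜) (L : GrSub M) : Function.Surjective (lin (M.mkQ L)) :=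
  L.toSubmodule.mkQ_surjective

theorem mkQ_eq_zero_iff {M : GrMod 𝒜} {L : GrSub M} {m : M.carrier} :
    lin (M.mkQ L) m = 0 ↔ m ∈ L.toSubmodule :=
  Submodule.Quotient.mk_eq_zero _

/-- A linear isomorphism that respects the gradings. -/
def isoOfLinearEquiv {M N : GrMod 𝒜} (e : M.carrier ≃ₗ[A] N.carrier)
    (h : ∀ i, ∀ m ∈ M.deg i, e m ∈ N.deg i) (h' : ∀ i, ∀ n ∈ N.deg i, e.symm n ∈ M.deg i) :
    M ≅ N where
  hom := Hom.mk (M := M) (N := N) e.toLinearMap h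
  inv := Hom.mk (M := N) (N := M) e.symm.toLinearMap h'
  hom_inv_id := hom_ext fun m => e.symm_apply_apply m
  inv_hom_id := hom_ext fun m => e.apply_symm_apply m

/-! ### Shifts -/

/-- Two shifts in succession. -/
def shiftShift (M : GrMod 𝒜) (a b c : ℤ) (h : a + b = c) : (M.shift a).shift b ≅ M.shift c :=
  isoOfLinearEquiv (M := (M.shift a).shift b) (N := M.shift c) (LinearEquiv.refl A M.carrier)
    (fun i m hm => by
      change m ∈ M.deg (i - c)
      rw [← h, add_comm a b, ← sub_sub]
      exact hm)
    (fun i m hm => by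
      change m ∈ M.deg (i - b - a)
      rw [sub_sub, add_comm b a, h]
      exact hm)

/-- The shift by zero. -/
def shiftZero (M : GrMod 𝒜) : M.shift 0 ≅ M :=
  isoOfLinearEquiv (M := M.shift 0) (N := M) (LinearEquiv.refl A M.carrier)
    (fun i m hm => by
      rw [← sub_zero i]
      exact hm)
    (fun i m hm => by
      change m ∈ M.deg (i - 0)
      rwa [sub_zero i])

/-- The shift of a morphism. -/
def shiftHom {M N : GrMod 𝒜} (f : M ⟶ N) (d : ℤ) : M.shift d ⟶ N.shift d :=
  Hom.mk (M := M.shift d) (N := N.shift d) (lin (M := M) (N := N) f) fun i m hm =>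
    f.map_deg (i - d) m hm

variable (𝒜) in
/-- The shift functor. -/
def shiftFunctor (d : ℤ) : GrMod 𝒜 ⥤ GrMod 𝒜 where
  obj M := M.shift d
  map f := shiftHom f d
  map_id _ := rfl
  map_comp _ _ := rfl

theorem shiftHom_injective {M N : GrMod 𝒜} (d : ℤ) :
    Function.Injective fun f : M ⟶ N => shiftHom f d := fun _ _ h =>
  hom_ext fun m => LinearMap.congr_fun
    (congrArg (fun u : M.shift d ⟶ N.shift d => lin u) h) m

theorem shiftHom_surjective {M N : GrMod 𝒜} {d : ℤ} (f : M.shift d ⟶ N.shift d) :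
    ∃ g : M ⟶ N, shiftHom g d = f :=
  ⟨Hom.mk (M := M) (N := N) (lin (M := M.shift d) (N := N.shift d) f) fun i m hm => by
    have h : m ∈ (M.shift d).deg (i + d) := by
      change m ∈ M.deg (i + d - d)
      rwa [add_sub_cancel_right]
    have : lin f m ∈ N.deg (i + d - d) := Hom.map_deg (M := M.shift d) (N := N.shift d) f _ _ h
    rwa [add_sub_cancel_right] at this, rfl⟩

instance (d : ℤ) : (shiftFunctor 𝒜 d).Faithful where
  map_injective h := shiftHom_injective d h

instance (d : ℤ) : (shiftFunctor 𝒜 d).Full where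
  map_surjective f := shiftHom_surjective f

instance (d : ℤ) : (shiftFunctor 𝒜 d).EssSurj where
  mem_essImage M :=
    ⟨M.shift (-d), ⟨show (M.shift (-d)).shift d ≅ M from
      (M.shiftShift (-d) d 0 (by simp)).trans M.shiftZero⟩⟩

instance (d : ℤ) : (shiftFunctor 𝒜 d).IsEquivalence where

instance (d : ℤ) : (shiftFunctor 𝒜 d).Additive where
  map_add {M N _ _} := hom_ext (M := M.shift d) (N := N.shift d) fun _ => rfl

/-! ### Degree bounds -/

/-- All nonzero homogeneous parts have degree at least `c`. -/
def IsGE (M : GrMod 𝒜) (c : ℤ) : Prop := ∀ i < c, M.deg i = ⊥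

/-- All nonzero homogeneous parts have degree at most `c`. -/
def IsLE (M : GrMod 𝒜) (c : ℤ) : Prop := ∀ i, c < i → M.deg i = ⊥

theorem hom_eq_zero_of_deg {M N : GrMod 𝒜} (f : M ⟶ N)
    (h : ∀ i, ∀ m ∈ M.deg i, lin f m = 0) : f = 0 := by
  have : (lin f).restrictScalars k = 0 := M.ext_deg h
  exact hom_ext fun m => LinearMap.congr_fun this m

theorem hom_eq_zero {M N : GrMod 𝒜} {c : ℤ} (hM : M.IsGE (c + 1)) (hN : N.IsLE c) (f : M ⟶ N) :
    f = 0 := by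
  refine hom_eq_zero_of_deg f fun i m hm => ?_
  by_cases h : i < c + 1
  · rw [hM i h, Submodule.mem_bot] at hm
    rw [hm, map_zero]
  · have := f.map_deg i m hm
    rwa [hN i (by omega), Submodule.mem_bot] at this

theorem IsGE.mono {M : GrMod 𝒜} {c c' : ℤ} (hM : M.IsGE c) (h : c' ≤ c) : M.IsGE c' :=
  fun i hi => hM i (by omega)

theorem IsLE.mono {M : GrMod 𝒜} {c c' : ℤ} (hM : M.IsLE c) (h : c ≤ c') : M.IsLE c' :=
  fun i hi => hM i (by omega)

theorem IsGE.shift {M : GrMod 𝒜} {c : ℤ} (hM : M.IsGE c) (d : ℤ) : (M.shift d).IsGE (c + d) :=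
  fun i hi => hM (i - d) (by omega)

theorem IsLE.shift {M : GrMod 𝒜} {c : ℤ} (hM : M.IsLE c) (d : ℤ) : (M.shift d).IsLE (c + d) :=
  fun i hi => hM (i - d) (by omega)

theorem IsGE.quot {M : GrMod 𝒜} {c : ℤ} (hM : M.IsGE c) (L : GrSub M) : (M.quot L).IsGE c := by
  intro i hi
  change (M.deg i).map _ = ⊥
  rw [hM i hi, Submodule.map_bot]

theorem IsGE.of_injective {M N : GrMod 𝒜} {c : ℤ} (hN : N.IsGE c) (f : M ⟶ N)
    (hf : Function.Injective (lin f)) : M.IsGE c := by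
  intro i hi
  refine (Submodule.eq_bot_iff _).2 fun m hm => hf ?_
  have := f.map_deg i m hm
  rw [hN i hi, Submodule.mem_bot] at this
  rw [this, map_zero]

theorem exists_lift {M N T : GrMod 𝒜} (f : M ⟶ N) (hf : Function.Injective (lin f)) (g : T ⟶ N)
    (hg : ∀ t, ∃ m, lin f m = lin g t) : ∃ h : T ⟶ M, h ≫ f = g := by
  obtain ⟨nm⟩ := normalMono f hf
  have w : g ≫ nm.g = 0 := hom_ext fun t => by
    obtain ⟨m, hm⟩ := hg t
    change lin nm.g (lin g t) = 0
    rw [← hm]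
    exact LinearMap.congr_fun (congrArg lin nm.w) m
  exact ⟨nm.isLimit.lift (KernelFork.ofι g w), nm.isLimit.fac _ WalkingParallelPair.zero⟩

theorem Filtration.antitone {M : GrMod 𝒜} (Φ : Filtration M) :
    Antitone fun i => (Φ.step i).toSubmodule :=
  antitone_nat_of_succ_le Φ.step_succ_le

variable [IsNoetherianRing A]

theorem shortExact_of (S : ShortComplex (GrMod 𝒜)) (hf : Function.Injective (lin S.f))
    (hg : Function.Surjective (lin S.g)) (h : ∀ x, lin S.g x = 0 → ∃ y, lin S.f y = x) :
    S.ShortExact where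
  exact := by
    rw [ShortComplex.exact_iff_exact_up_to_refinements]
    intro T x hx
    obtain ⟨y, hy⟩ := exists_lift S.f hf x fun t =>
      h _ (LinearMap.congr_fun (congrArg lin hx) t)
    exact ⟨T, 𝟙 T, inferInstance, y, by rw [hy, Category.id_comp]⟩
  mono_f := mono_of_injective _ hf
  epi_g := epi_of_surjective _ hg

/-- The short exact sequence of a graded submodule. -/
def subComplex (M : GrMod 𝒜) (L : GrSub M) : ShortComplex (GrMod 𝒜) :=
  ShortComplex.mk (M.subtype L) (M.mkQ L)
    (hom_ext fun m => mkQ_eq_zero_iff.2 m.2)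

theorem subComplex_shortExact (M : GrMod 𝒜) (L : GrSub M) : (M.subComplex L).ShortExact :=
  shortExact_of _ L.toSubmodule.subtype_injective (mkQ_surjective M L)
    fun x hx => ⟨⟨x, mkQ_eq_zero_iff.1 hx⟩, rfl⟩

theorem IsGE.sub {M : GrMod 𝒜} {c : ℤ} (hM : M.IsGE c) (L : GrSub M) : (M.sub L).IsGE c :=
  hM.of_injective (M.subtype L) L.toSubmodule.subtype_injective

/-- The inclusion of a graded submodule in a larger one. -/
def inclusion {M : GrMod 𝒜} {L L' : GrSub M} (h : L.toSubmodule ≤ L'.toSubmodule) :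
    M.sub L ⟶ M.sub L' :=
  Hom.mk (M := M.sub L) (N := M.sub L') (Submodule.inclusion h) fun _ _ hm => hm

theorem exists_desc {M N T : GrMod 𝒜} (g : M ⟶ N) (hg : Function.Surjective (lin g)) (f : M ⟶ T)
    (h : ∀ m, lin g m = 0 → lin f m = 0) : ∃ u : N ⟶ T, g ≫ u = f := by
  obtain ⟨ne⟩ := normalEpi g hg
  have w : ne.g ≫ f = 0 := hom_ext fun t => h _ (LinearMap.congr_fun (congrArg lin ne.w) t)
  exact ⟨ne.isColimit.desc (CokernelCofork.ofπ f w), ne.isColimit.fac _ WalkingParallelPair.one⟩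

/-- The shift is an exact autoequivalence that preserves projectives, so it is bijective on `Ext`.
This is how a factor `K̃_a⟨d⟩` is traded for a smaller degree of the target. -/
theorem subsingleton_ext_shift [EnoughProjectives (GrMod 𝒜)] (M N : GrMod 𝒜) (d : ℤ) (i : ℕ)
    (h : Subsingleton (Abelian.Ext M N i)) :
    Subsingleton (Abelian.Ext (M.shift d) (N.shift d) i) := by
  have := ((shiftFunctor 𝒜 d).mapExt_bijective_of_preservesProjectiveObjects M N i).surjective
  exact this.subsingleton (β := Abelian.Ext ((shiftFunctor 𝒜 d).obj M) ((shiftFunctor 𝒜 d).obj N) i)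

/-! ### Filtrations -/

namespace Filtration

variable {M : GrMod 𝒜} (Φ : Filtration M)

/-- The short exact sequence of two consecutive steps of a filtration. -/
def complex (i : ℕ) : ShortComplex (GrMod 𝒜) :=
  ShortComplex.mk (X₁ := M.sub (Φ.step (i + 1))) (X₂ := M.sub (Φ.step i)) (X₃ := Φ.factor i)
    (inclusion (Φ.step_succ_le i)) (mkQ _ _)
    (hom_ext fun m => mkQ_eq_zero_iff.2 m.2)

theorem complex_shortExact (i : ℕ) : (Φ.complex i).ShortExact :=
  shortExact_of _ (Submodule.inclusion_injective (Φ.step_succ_le i)) (mkQ_surjective _ _)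
    fun x hx => ⟨⟨x.1, mkQ_eq_zero_iff (M := M.sub (Φ.step i))
      (L := (Φ.step (i + 1)).comap (M.subtype (Φ.step i))).1 hx⟩, rfl⟩

/-- A separable filtration of a module with finite-dimensional homogeneous parts leaves every
finite range of degrees. -/
theorem exists_isGE (hΦ : ⨅ i, (Φ.step i).toSubmodule = ⊥) {b : ℤ} (hb : M.IsGE b)
    (hfin : ∀ i, FiniteDimensional k (M.deg i)) (c : ℤ) :
    ∃ j₀, ∀ j ≥ j₀, (M.sub (Φ.step j)).IsGE c := by
  have key : ∀ i : ℤ, ∃ j₀, ∀ j ≥ j₀, (M.sub (Φ.step j)).deg i = ⊥ := by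
    intro i
    -- The traces of the steps on one homogeneous part form a descending chain in a
    -- finite-dimensional space; its stable value lies in every step, hence is zero.
    let u : ℕ →o (Submodule k (M.deg i))ᵒᵈ :=
      ⟨fun j => OrderDual.toDual
        (((Φ.step j).toSubmodule.restrictScalars k).comap (M.deg i).subtype),
        fun a b hab x hx => Φ.antitone hab hx⟩
    obtain ⟨j₀, hj₀⟩ := WellFoundedGT.monotone_chain_condition u
    have hbot : ∀ x : M.deg i, (x : M.carrier) ∈ (Φ.step j₀).toSubmodule → (x : M.carrier) = 0 := by
      intro x hx
      rw [← Submodule.mem_bot A, ← hΦ, Submodule.mem_iInf]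
      intro j
      rcases le_total j₀ j with h | h
      · have : x ∈ OrderDual.ofDual (u j) := by
          rw [← hj₀ j h]
          exact hx
        exact this
      · exact Φ.antitone h hx
    refine ⟨j₀, fun j hj => (Submodule.eq_bot_iff _).2 fun m hm => Subtype.ext ?_⟩
    exact hbot ⟨m.1, hm⟩ (Φ.antitone hj m.2)
  choose J hJ using key
  -- Below `b` there is nothing, so only the finitely many degrees from `b` to `c - 1` need a bound.
  refine ⟨(Finset.Ico b c).sup J, fun j hj i hi => ?_⟩
  by_cases h : i < b
  · exact hb.sub _ i h
  · exact hJ i j ((Finset.le_sup (f := J) (Finset.mem_Ico.2 ⟨not_lt.1 h, hi⟩)).trans hj)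

end Filtration

end GrMod

section skew

variable {W : Type uA} [Group W] {n : ℕ} [MulSemiringAction W (PolyRing n)]
  [SMulCommClass W ℂ (PolyRing n)]

open SkewMonoidAlgebra (single)

/-! ## Homomorphisms out of the modules `S ⊗ V` -/

theorem single_one_smul_mem (M : SkewMod W n) (w : W) {d : ℤ} {m : M.carrier} (hm : m ∈ M.deg d) :
    (single w 1 : SkewAlg W n) • m ∈ M.deg d := by
  have h : (1 : PolyRing n) ∈ polyDeg n 0 := MvPolynomial.isHomogeneous_one _ _
  simpa using M.smul_mem (single_mem_skewDeg w h) hm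

theorem single_one_smul_smul (M : SkewMod W n) (v w : W) (m : M.carrier) :
    (single v 1 : SkewAlg W n) • (single w 1 : SkewAlg W n) • m =
      (single (v * w) 1 : SkewAlg W n) • m := by
  rw [smul_smul, SkewMonoidAlgebra.single_mul_single]
  simp

/-- The representation of `W` on a stable subspace of a module over `S * W`. -/
def stableRep (M : SkewMod W n) (U : Submodule ℂ M.carrier)
    (hU : ∀ w : W, ∀ u ∈ U, (single w 1 : SkewAlg W n) • u ∈ U) : Representation ℂ W U where
  toFun w := (Algebra.lsmul ℂ ℂ M.carrier (single w 1 : SkewAlg W n)).restrict (hU w)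
  map_one' := by
    ext u
    change (single 1 1 : SkewAlg W n) • (u : M.carrier) = u
    rw [SkewMonoidAlgebra.single_one_one, one_smul]
  map_mul' v w := by
    ext u
    exact (single_one_smul_smul M v w u).symm

theorem coe_stableRep (M : SkewMod W n) (U : Submodule ℂ M.carrier)
    (hU : ∀ w : W, ∀ u ∈ U, (single w 1 : SkewAlg W n) • u ∈ U) (w : W) (u : U) :
    (stableRep M U hU w u : M.carrier) = (single w 1 : SkewAlg W n) • (u : M.carrier) := rfl

variable {V : Type} [AddCommGroup V] [Module ℂ V] (ρ : Representation ℂ W V)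

/-- The equivariant maps from a representation `ρ` to the part of degree `d` of `M`. -/
def multSpace (M : SkewMod W n) (d : ℤ) : Submodule ℂ (V →ₗ[ℂ] M.carrier) where
  carrier := {f | (∀ v, f v ∈ M.deg d) ∧
    ∀ (w : W) v, f (ρ w v) = (single w 1 : SkewAlg W n) • f v}
  add_mem' := fun hf hg => ⟨fun v => Submodule.add_mem _ (hf.1 v) (hg.1 v),
    fun w v => by simp [hf.2, hg.2]⟩
  zero_mem' := ⟨fun v => Submodule.zero_mem _, fun w v => by simp⟩
  smul_mem' := fun c f hf => ⟨fun v => Submodule.smul_mem _ c (hf.1 v),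
    fun w v => by rw [LinearMap.smul_apply, LinearMap.smul_apply, hf.2, smul_comm]⟩

/-- The map `p ⊗ v ↦ p f(v)`. -/
def tensorMap (M : SkewMod W n) (f : V →ₗ[ℂ] M.carrier) : PolyRing n ⊗[ℂ] V →ₗ[ℂ] M.carrier :=
  TensorProduct.lift (LinearMap.mk₂ ℂ (fun p v => (single 1 p : SkewAlg W n) • f v)
    (fun p q v => by rw [SkewMonoidAlgebra.single_add, add_smul])
    (fun c p v => by rw [← SkewMonoidAlgebra.smul_single, smul_assoc])
    (fun p u v => by rw [map_add, smul_add])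
    (fun c p v => by rw [map_smul, smul_comm]))

theorem tensorMap_tmul (M : SkewMod W n) (f : V →ₗ[ℂ] M.carrier) (p : PolyRing n) (v : V) :
    tensorMap M f (p ⊗ₜ v) = (single 1 p : SkewAlg W n) • f v := rfl

theorem tensorMap_projAction (M : SkewMod W n) {d : ℤ} {f : V →ₗ[ℂ] M.carrier}
    (hf : f ∈ multSpace ρ M d) (a : SkewAlg W n) (x : PolyRing n ⊗[ℂ] V) :
    tensorMap M f (projAction ρ a x) = a • tensorMap M f x := by
  induction a using SkewMonoidAlgebra.induction_on' with
  | single w s =>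
    induction x using TensorProduct.induction_on with
    | zero => simp
    | add x y hx hy => simp only [map_add, hx, hy, smul_add]
    | tmul p v =>
      rw [projAction_single, tensorMap_tmul, tensorMap_tmul, hf.2, smul_smul, smul_smul,
        SkewMonoidAlgebra.single_mul_single, SkewMonoidAlgebra.single_mul_single]
      simp
  | add a b ha hb => simp only [map_add, LinearMap.add_apply, ha, hb, add_smul]

theorem comp_mem_multSpace {M N : SkewMod W n} {d : ℤ} (g : M ⟶ N) {f : V →ₗ[ℂ] M.carrier}
    (hf : f ∈ multSpace ρ M d) :
    (GrMod.lin g).restrictScalars ℂ ∘ₗ f ∈ multSpace ρ N d :=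
  ⟨fun v => g.map_deg d _ (hf.1 v), fun w v => by
    change GrMod.lin g (f (ρ w v)) = _
    rw [hf.2, map_smul]
    rfl⟩

/-- Equivariant maps lift along surjections, by averaging. -/
theorem exists_multSpace_lift [Finite W] {M N : SkewMod W n} (e : M ⟶ N)
    (he : Function.Surjective (GrMod.lin e)) {d : ℤ} {f : V →ₗ[ℂ] N.carrier}
    (hf : f ∈ multSpace ρ N d) :
    ∃ g ∈ multSpace ρ M d, ∀ v, GrMod.lin e (g v) = f v := by
  have := Fintype.ofFinite W
  obtain ⟨s, hs⟩ := ((GrMod.lin e).restrictScalars ℂ).exists_rightInverse_of_surjective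
    (LinearMap.range_eq_top.2 he)
  have hs' : ∀ y, GrMod.lin e (s y) = y := fun y => LinearMap.congr_fun hs y
  -- A linear lift into degree `d`, not yet equivariant; `g` is its average over `W`.
  let g₀ : V →ₗ[ℂ] M.carrier := M.proj d ∘ₗ s ∘ₗ f
  have hg₀ : ∀ v, GrMod.lin e (g₀ v) = f v := fun v => by
    change GrMod.lin e (M.proj d (s (f v))) = f v
    rw [GrMod.lin_proj, hs', N.proj_of_mem (hf.1 v)]
  let g : V →ₗ[ℂ] M.carrier := (Fintype.card W : ℂ)⁻¹ •
    ∑ w : W, Algebra.lsmul ℂ ℂ M.carrier (single w 1 : SkewAlg W n) ∘ₗ g₀ ∘ₗ ρ w⁻¹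
  have hg : ∀ v, g v = (Fintype.card W : ℂ)⁻¹ •
      ∑ w : W, (single w 1 : SkewAlg W n) • g₀ (ρ w⁻¹ v) := fun v => by
    simp [g]
  refine ⟨g, ⟨fun v => ?_, fun u v => ?_⟩, fun v => ?_⟩
  · rw [hg]
    exact Submodule.smul_mem _ _ (Submodule.sum_mem _ fun w _ =>
      single_one_smul_mem M w (M.proj_mem d _))
  · rw [hg, hg, smul_comm, Finset.smul_sum (r := (single u 1 : SkewAlg W n))]
    rw [← Equiv.sum_comp (Equiv.mulLeft u)]
    refine congrArg _ (Finset.sum_congr rfl fun w _ => ?_)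
    rw [single_one_smul_smul, Equiv.coe_mulLeft, ← Module.End.mul_apply, ← map_mul, mul_inv_rev,
      inv_mul_cancel_right]
  · have h : ∀ w : W, GrMod.lin e ((single w 1 : SkewAlg W n) • g₀ (ρ w⁻¹ v)) = f v := fun w => by
      rw [map_smul, hg₀, ← hf.2, ← Module.End.mul_apply, ← map_mul, mul_inv_cancel, map_one,
        Module.End.one_apply]
    rw [hg]
    refine (((GrMod.lin e).restrictScalars ℂ).map_smul _ _).trans ?_
    change _ • GrMod.lin e _ = _
    rw [map_sum, Finset.sum_congr rfl fun w _ => h w, Finset.sum_const, Finset.card_univ,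
      ← Nat.cast_smul_eq_nsmul ℂ, smul_smul, inv_mul_cancel₀, one_smul]
    exact_mod_cast Fintype.card_ne_zero

variable [FiniteDimensional ℂ V] [PreservesDegree W n]

theorem projModule_single_smul (w : W) (s p : PolyRing n) (v : V) :
    (single w s : SkewAlg W n) • (show (projModule (n := n) ρ).carrier from p ⊗ₜ[ℂ] v) =
      (show (projModule (n := n) ρ).carrier from (s * w • p) ⊗ₜ[ℂ] ρ w v) :=
  projAction_single ρ w s p v

/-- The homomorphism from `(S ⊗ V)⟨d⟩` that extends an equivariant map from `V`. -/
def projHom {M : SkewMod W n} {d : ℤ} {f : V →ₗ[ℂ] M.carrier} (hf : f ∈ multSpace ρ M d) :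
    (projModule (n := n) ρ).shift d ⟶ M :=
  GrMod.Hom.mk (M := (projModule (n := n) ρ).shift d) (N := M)
    { toFun := tensorMap M f
      map_add' := fun x y => map_add _ x y
      map_smul' := fun a x => tensorMap_projAction ρ M hf a x }
    (by
      intro i m hm
      have : tensorDeg n V (i - d) ≤ (M.deg i).comap (tensorMap M f) :=
        tensorDeg_le fun p hp v => by
          have := M.smul_mem (single_mem_skewDeg (1 : W) hp) (hf.1 v)
          rwa [sub_add_cancel] at this
      exact this hm)

/-- The generators of `S ⊗ V`. -/
def genMap : V →ₗ[ℂ] (projModule (n := n) ρ).carrier := TensorProduct.mk ℂ (PolyRing n) V 1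

theorem genMap_mem (d : ℤ) :
    (genMap ρ : V →ₗ[ℂ] ((projModule (n := n) ρ).shift d).carrier) ∈
      multSpace ρ ((projModule (n := n) ρ).shift d) d := by
  refine ⟨fun v => ?_, fun w v => ?_⟩
  · change (1 : PolyRing n) ⊗ₜ[ℂ] v ∈ tensorDeg n V (d - d)
    rw [sub_self]
    exact tmul_mem_tensorDeg (MvPolynomial.isHomogeneous_one _ _) v
  · refine Eq.trans ?_ (projModule_single_smul ρ w 1 1 v).symm
    rw [smul_one, mul_one]
    rfl

theorem projHom_gen {M : SkewMod W n} {d : ℤ} {f : V →ₗ[ℂ] M.carrier}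
    (hf : f ∈ multSpace ρ M d) (v : V) :
    GrMod.lin (projHom ρ hf) (genMap ρ v : (projModule (n := n) ρ).carrier) = f v := by
  change (single 1 1 : SkewAlg W n) • f v = f v
  rw [SkewMonoidAlgebra.single_one_one, one_smul]

theorem span_genMap : Submodule.span (SkewAlg W n) (Set.range (genMap (n := n) ρ)) = ⊤ := by
  rw [eq_top_iff]
  rintro (x : PolyRing n ⊗[ℂ] V) -
  induction x using TensorProduct.induction_on with
  | zero => exact Submodule.zero_mem _
  | add x y hx hy => exact Submodule.add_mem _ hx hy
  | tmul p v =>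
    have := Submodule.smul_mem (Submodule.span (SkewAlg W n) (Set.range (genMap (n := n) ρ)))
      (single 1 p : SkewAlg W n) (Submodule.subset_span ⟨v, rfl⟩)
    have h := projModule_single_smul ρ 1 p 1 v
    rw [one_smul, mul_one, map_one] at h
    rwa [show genMap (n := n) ρ v = (show (projModule (n := n) ρ).carrier from 1 ⊗ₜ[ℂ] v) from rfl,
      h] at this

theorem projModule_hom_ext {M : SkewMod W n} {d : ℤ} {f g : (projModule (n := n) ρ).shift d ⟶ M}
    (h : ∀ v, GrMod.lin f (genMap ρ v : (projModule (n := n) ρ).carrier) =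
      GrMod.lin g (genMap ρ v : (projModule (n := n) ρ).carrier)) : f = g := by
  refine GrMod.lin_injective (LinearMap.ext_on_range (v := genMap (n := n) ρ) ?_ h)
  exact span_genMap ρ

/-- Homomorphisms from `(S ⊗ V)⟨d⟩` to `M` are equivariant maps from `V` to `M_d`. -/
def projHomEquiv (M : SkewMod W n) (d : ℤ) :
    ((projModule (n := n) ρ).shift d ⟶ M) ≃ₗ[ℂ] multSpace ρ M d where
  toFun f := ⟨_, comp_mem_multSpace ρ f (genMap_mem ρ d)⟩
  map_add' _ _ := rfl
  map_smul' _ _ := rfl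
  invFun f := projHom ρ f.2
  left_inv _ := projModule_hom_ext ρ fun v => projHom_gen ρ _ v
  right_inv f := Subtype.ext (LinearMap.ext fun v => projHom_gen ρ f.2 v)

theorem projModule_isGE : (projModule (n := n) ρ).IsGE 0 := by
  intro i hi
  refine le_bot_iff.1 (tensorDeg_le (N := ⊥) fun p hp v => ?_)
  obtain ⟨j, rfl⟩ := Int.eq_negSucc_of_lt_zero hi
  rw [(Submodule.mem_bot ℂ).1 hp, TensorProduct.zero_tmul]
  exact Submodule.zero_mem _

instance polyDeg_finite (i : ℤ) : FiniteDimensional ℂ (polyDeg n i) := by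
  cases i with
  | ofNat d => exact Module.Finite.iff_fg.2 (MvPolynomial.homogeneousSubmodule_fg _ _ d)
  | negSucc d => exact inferInstanceAs (FiniteDimensional ℂ (⊥ : Submodule ℂ (PolyRing n)))

theorem projModule_deg_finite (i : ℤ) :
    FiniteDimensional ℂ ((projModule (n := n) ρ).deg i) :=
  inferInstanceAs (FiniteDimensional ℂ
    (LinearMap.range (LinearMap.rTensor V (polyDeg n i).subtype)))

/-! ### Projectivity -/

variable [Finite W]

/-- A map out of `(S ⊗ V)⟨d⟩` is determined by an equivariant map on `V`, so lifting reduces to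
`exists_multSpace_lift`. -/
instance projModule_projective (d : ℤ) : Projective ((projModule (n := n) ρ).shift d) where
  factors {N M} f e he := by
    obtain ⟨g, hg, h⟩ := exists_multSpace_lift ρ e (GrMod.surjective_of_epi e)
      (comp_mem_multSpace ρ f (genMap_mem ρ d))
    refine ⟨projHom ρ hg, projModule_hom_ext ρ fun v => ?_⟩
    change GrMod.lin e (GrMod.lin (projHom ρ hg) _) = _
    rw [projHom_gen, h]
    rfl

end skew

/-! ### Direct sums of graded modules -/

namespace GrMod

variable {k : Type uk} {A : Type uA} [Field k] [Ring A] [Algebra k A] {𝒜 : ℤ → Submodule k A}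

/-- The homomorphism from a direct sum given by homomorphisms from the summands. -/
def prodDesc {M N T : GrMod 𝒜} (f : M ⟶ T) (g : N ⟶ T) : M.prod N ⟶ T :=
  Hom.mk (M := M.prod N) (N := T) (LinearMap.coprod (lin f) (lin g)) fun i _ hm =>
    Submodule.add_mem _ (f.map_deg i _ hm.1) (g.map_deg i _ hm.2)

/-- The inclusion of the first summand. -/
def prodInl (M N : GrMod 𝒜) : M ⟶ M.prod N :=
  Hom.mk (M := M) (N := M.prod N) (LinearMap.inl A _ _) fun _ _ hm => ⟨hm, Submodule.zero_mem _⟩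

/-- The inclusion of the second summand. -/
def prodInr (M N : GrMod 𝒜) : N ⟶ M.prod N :=
  Hom.mk (M := N) (N := M.prod N) (LinearMap.inr A _ _) fun _ _ hm => ⟨Submodule.zero_mem _, hm⟩

theorem projective_prod (M N : GrMod 𝒜) [Projective M] [Projective N] :
    Projective (M.prod N) where
  factors {E X} f e _ := by
    refine ⟨prodDesc (Projective.factorThru (prodInl M N ≫ f) e)
      (Projective.factorThru (prodInr M N ≫ f) e), hom_ext fun m => ?_⟩
    have h₁ := LinearMap.congr_fun (congrArg lin (Projective.factorThru_comp (prodInl M N ≫ f) e)) m.1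
    have h₂ := LinearMap.congr_fun (congrArg lin (Projective.factorThru_comp (prodInr M N ≫ f) e)) m.2
    change lin e (lin (Projective.factorThru (prodInl M N ≫ f) e) m.1 +
      lin (Projective.factorThru (prodInr M N ≫ f) e) m.2) = lin f m
    rw [map_add]
    refine (congrArg₂ (· + ·) h₁ h₂).trans ?_
    refine ((lin f).map_add (lin (prodInl M N) m.1) (lin (prodInr M N) m.2)).symm.trans ?_
    exact congrArg (lin f) (Prod.ext (add_zero m.1) (zero_add m.2))

theorem IsGE.prod {M N : GrMod 𝒜} {c : ℤ} (hM : M.IsGE c) (hN : N.IsGE c) :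
    (M.prod N).IsGE c := by
  intro i hi
  change (M.deg i).prod (N.deg i) = ⊥
  rw [hM i hi, hN i hi, Submodule.prod_bot]

end GrMod

section skew

variable {W : Type uA} [Group W] {n : ℕ} [MulSemiringAction W (PolyRing n)]
  [SMulCommClass W ℂ (PolyRing n)]

open SkewMonoidAlgebra (single)

/-! ### Projective covers with degree bounds, and vanishing of Ext by degrees -/

section cover

/-- The submodule `L` of `M` is covered by a projective module that respects the lower degree
bounds of `M`. -/
def HasCover (M : SkewMod W n) (L : Submodule (SkewAlg W n) M.carrier) : Prop :=
  ∃ (Q : SkewMod W n) (f : Q ⟶ M), Projective Q ∧ (∀ c, M.IsGE c → Q.IsGE c) ∧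
    L ≤ LinearMap.range (GrMod.lin f)

theorem HasCover.sup {M : SkewMod W n} {L L' : Submodule (SkewAlg W n) M.carrier}
    (h : HasCover M L) (h' : HasCover M L') : HasCover M (L ⊔ L') := by
  obtain ⟨Q, f, hQ, hc, hf⟩ := h
  obtain ⟨Q', f', hQ', hc', hf'⟩ := h'
  refine ⟨Q.prod Q', GrMod.prodDesc f f', GrMod.projective_prod Q Q',
    fun c hM => (hc c hM).prod (hc' c hM), sup_le ?_ ?_⟩
  · intro m hm
    obtain ⟨x, hx⟩ := hf hm
    refine ⟨(x, 0), ?_⟩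
    change GrMod.lin f x + GrMod.lin f' 0 = m
    rw [hx, map_zero, add_zero]
  · intro m hm
    obtain ⟨x, hx⟩ := hf' hm
    refine ⟨(0, x), ?_⟩
    change GrMod.lin f 0 + GrMod.lin f' x = m
    rw [hx, map_zero, zero_add]

theorem hasCover_bot (M : SkewMod W n) : HasCover M ⊥ :=
  ⟨GrMod.zeroObj, 0, ⟨fun _ _ _ => ⟨0, GrMod.hom_ext fun m => by
    rw [show m = 0 from rfl, map_zero, map_zero]⟩⟩, fun _ _ _ _ =>
    (Submodule.eq_bot_iff _).2 fun _ _ => rfl, bot_le⟩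

variable [PreservesDegree W n] [Finite W]

/-- The `W`-orbit of `m` spans a finite-dimensional representation `U` inside degree `i`, and `(S ⊗
U)⟨i⟩` maps onto the submodule generated by `m`. -/
theorem hasCover_span_of_mem {M : SkewMod W n} {i : ℤ} {m : M.carrier} (hm : m ∈ M.deg i) :
    HasCover M (Submodule.span (SkewAlg W n) {m}) := by
  -- A zero element lies in every degree, so `i` would not be controlled by the lower bound of `M`.
  by_cases h0 : m = 0
  · rw [h0, Submodule.span_singleton_eq_bot.2 rfl]
    exact hasCover_bot M
  let U : Submodule ℂ M.carrier :=
    Submodule.span ℂ (Set.range fun w : W => (single w 1 : SkewAlg W n) • m)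
  have hU : ∀ w : W, ∀ u ∈ U, (single w 1 : SkewAlg W n) • u ∈ U := by
    intro w u hu
    induction hu using Submodule.span_induction with
    | mem x hx =>
      obtain ⟨v, rfl⟩ := hx
      exact Submodule.subset_span ⟨w * v, (single_one_smul_smul M w v m).symm⟩
    | zero => rw [smul_zero]; exact Submodule.zero_mem _
    | add x y _ _ hx hy => rw [smul_add]; exact Submodule.add_mem _ hx hy
    | smul c x _ hx => rw [smul_comm]; exact Submodule.smul_mem _ c hx
  have : FiniteDimensional ℂ U := FiniteDimensional.span_of_finite ℂ (Set.finite_range _)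
  have hdeg : U ≤ M.deg i := Submodule.span_le.2 (by
    rintro _ ⟨w, rfl⟩
    exact single_one_smul_mem M w hm)
  have hf : U.subtype ∈ multSpace (stableRep M U hU) M i :=
    ⟨fun u => hdeg u.2, fun w u => coe_stableRep M U hU w u⟩
  have hmU : m ∈ U := Submodule.subset_span ⟨1, by
    change (single 1 1 : SkewAlg W n) • m = m
    rw [SkewMonoidAlgebra.single_one_one, one_smul]⟩
  refine ⟨_, projHom (stableRep M U hU) hf, inferInstance, fun c hM => ?_, ?_⟩
  · have hci : c ≤ i := by
      by_contra h
      rw [hM i (not_le.1 h), Submodule.mem_bot] at hm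
      exact h0 hm
    have := (projModule_isGE (n := n) (stableRep M U hU)).shift i
    rw [zero_add] at this
    exact this.mono hci
  · rw [Submodule.span_singleton_le_iff_mem]
    exact ⟨_, projHom_gen _ hf ⟨m, hmU⟩⟩

/-- A generator need not be homogeneous. Since a cover only has to contain the given submodule, it
is enough to cover the span of the homogeneous components. -/
theorem hasCover_top (M : SkewMod W n) : HasCover M ⊤ := by
  refine Submodule.fg_induction (motive := fun N _ => HasCover M N) (fun x => ?_)
    (fun _ _ _ _ h h' => h.sup h') ⊤ Module.Finite.fg_top
  obtain ⟨s, hs⟩ := M.exists_sum_proj x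
  have : HasCover M (s.sup fun i => Submodule.span (SkewAlg W n) {M.proj i x}) :=
    Finset.sup_induction (hasCover_bot M) (fun _ h _ h' => h.sup h')
      fun i _ => hasCover_span_of_mem (M.proj_mem i x)
  obtain ⟨Q, f, hQ, hc, hf⟩ := this
  refine ⟨Q, f, hQ, hc, ?_⟩
  rw [Submodule.span_singleton_le_iff_mem, hs]
  refine Submodule.sum_mem _ fun i hi => hf ?_
  exact Finset.le_sup (f := fun i => Submodule.span (SkewAlg W n) {M.proj i x}) hi
    (Submodule.mem_span_singleton_self _)

/-- Every graded module is covered by a projective one that respects its lower degree bounds. -/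
theorem exists_cover (M : SkewMod W n) : ∃ (Q : SkewMod W n) (f : Q ⟶ M), Projective Q ∧
    (∀ c, M.IsGE c → Q.IsGE c) ∧ Function.Surjective (GrMod.lin f) := by
  obtain ⟨Q, f, hQ, hc, hf⟩ := hasCover_top M
  exact ⟨Q, f, hQ, hc, LinearMap.range_eq_top.1 (top_le_iff.1 hf)⟩

instance : EnoughProjectives (SkewMod W n) where
  presentation M := by
    obtain ⟨Q, f, hQ, _, hf⟩ := exists_cover M
    exact ⟨{ p := Q, projective := hQ, f := f, epi := GrMod.epi_of_surjective f hf }⟩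

/-- There are no extensions between modules in disjoint ranges of degrees. -/
theorem subsingleton_ext_of_deg {c : ℤ} {X : SkewMod W n} (hX : X.IsLE c) (i : ℕ)
    {M : SkewMod W n} (hM : M.IsGE (c + 1)) : Subsingleton (Abelian.Ext M X i) := by
  induction i generalizing M with
  | zero =>
    have : Subsingleton (M ⟶ X) := subsingleton_of_forall_eq 0 fun f => GrMod.hom_eq_zero hM hX f
    exact Abelian.Ext.addEquiv₀.injective.subsingleton
  | succ i ih =>
    -- The cover stays in degrees at least `c + 1`, hence so does its kernel, to which the induction
    -- hypothesis applies.
    obtain ⟨Q, f, hQ, hc, hf⟩ := exists_cover M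
    let S : ShortComplex (SkewMod W n) := ShortComplex.mk (Q.subtype (GrMod.ker f)) f
      (GrMod.hom_ext fun m => (m.2 : GrMod.lin f m.1 = 0))
    have hS : S.ShortExact := GrMod.shortExact_of S
      (GrMod.ker f).toSubmodule.subtype_injective hf fun x hx => ⟨⟨x, hx⟩, rfl⟩
    have : Projective S.X₂ := hQ
    exact Abelian.Ext.subsingleton_right hS X i (ih ((hc _ hM).sub _))

end cover

/-! ## Multiplicities -/

section mult

variable {V : Type} [AddCommGroup V] [Module ℂ V] (ρ : Representation ℂ W V)

/-- The representation of `W` on a homogeneous part. -/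
def degRep (M : SkewMod W n) (d : ℤ) : Representation ℂ W (M.deg d) :=
  stableRep M (M.deg d) fun w _ hu => single_one_smul_mem M w hu

/-- The equivariant maps to `M_d`, as intertwining maps. -/
def multSpaceEquiv (M : SkewMod W n) (d : ℤ) :
    multSpace ρ M d ≃ₗ[ℂ] Representation.IntertwiningMap ρ (degRep M d) where
  toFun f := (f.1.codRestrict (M.deg d) f.2.1).intertwiningMap_of_isIntertwiningMap ρ (degRep M d)
    fun w v => Subtype.ext (f.2.2 w v)
  map_add' _ _ := rfl
  map_smul' _ _ := rfl
  invFun g := ⟨(M.deg d).subtype ∘ₗ g.toLinearMap, fun v => (g.toLinearMap v).2,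
    fun w v => congrArg Subtype.val (LinearMap.congr_fun (g.isIntertwining' w) v)⟩
  left_inv _ := rfl
  right_inv _ := rfl

theorem finrank_intertwiningMap_congr {V₁ V₂ : Type} [AddCommGroup V₁] [Module ℂ V₁]
    [AddCommGroup V₂] [Module ℂ V₂] {σ : Representation ℂ W V₁} {τ : Representation ℂ W V₂}
    (φ : σ.Equiv τ) : Module.finrank ℂ (Representation.IntertwiningMap ρ σ) =
      Module.finrank ℂ (Representation.IntertwiningMap ρ τ) :=
  LinearEquiv.finrank_eq
    { toFun := fun f => φ.toIntertwiningMap.comp f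
      map_add' := fun f g => Representation.IntertwiningMap.add_comp _ _ _ _ _ _
      map_smul' := fun c f => by
        ext v
        exact φ.toLinearEquiv.map_smul c (f v)
      invFun := fun f => φ.symm.toIntertwiningMap.comp f
      left_inv := fun f => by
        ext v
        exact φ.toLinearEquiv.symm_apply_apply (f v)
      right_inv := fun f => by
        ext v
        exact φ.toLinearEquiv.apply_symm_apply (f v) }

theorem extend_mem_dualDeg (M : SkewMod W n) [FiniteDimensional ℂ M.carrier] (d : ℤ)
    (ξ : Module.Dual ℂ (M.deg (-d))) :
    (ξ ∘ₗ (M.proj (-d)).codRestrict _ (M.proj_mem (-d)) : Module.Dual ℂ M.carrier) ∈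
      dualDeg M d := by
  intro j hj m hm
  change ξ ⟨M.proj (-d) m, _⟩ = 0
  rw [← map_zero ξ]
  exact congrArg ξ (Subtype.ext (M.proj_of_mem_ne hj hm))

/-- An equivariant map from an irreducible representation is injective or zero. -/
theorem multSpace_injective_or_eq_zero {M : SkewMod W n} (l : Irr W) {d : ℤ}
    {f : l.rep.V →ₗ[ℂ] M.carrier} (hf : f ∈ multSpace l.rep.ρ M d) :
    Function.Injective f ∨ f = 0 := by
  have := l.rep.irreducible
  rcases Representation.IsIrreducible.injective_or_eq_zero
    (multSpaceEquiv l.rep.ρ M d ⟨f, hf⟩) with h | h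
  · exact Or.inl fun x y hxy => h (Subtype.ext hxy)
  · rw [LinearEquiv.map_eq_zero_iff] at h
    exact Or.inr (congrArg Subtype.val h)

variable [PreservesDegree W n]

theorem single_smul_dual (M : SkewMod W n) [FiniteDimensional ℂ M.carrier] (w : W)
    (s : PolyRing n) (f : (dualModule M).carrier) (m : M.carrier) :
    (show Module.Dual ℂ M.carrier from (single w s : SkewAlg W n) • f) m =
      (show Module.Dual ℂ M.carrier from f) ((single w⁻¹ (w⁻¹ • s) : SkewAlg W n) • m) := by
  rw [← skewOp_single]
  rfl

/-- The part of degree `d` of the dual of `M` is the dual of `M_{-d}`. -/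
def dualDegEquiv (M : SkewMod W n) [FiniteDimensional ℂ M.carrier] (d : ℤ) :
    (degRep (dualModule M) d).Equiv (degRep M (-d)).dual :=
  Representation.Equiv.mk
    (LinearEquiv.ofLinearMap
      (M := (dualModule M).deg d) (M₂ := Module.Dual ℂ (M.deg (-d)))
      { toFun := fun f => (show Module.Dual ℂ M.carrier from f.1) ∘ₗ (M.deg (-d)).subtype
        map_add' := fun _ _ => rfl
        map_smul' := fun _ _ => rfl }
      { toFun := fun ξ => ⟨(ξ ∘ₗ (M.proj (-d)).codRestrict _ (M.proj_mem (-d)) :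
          Module.Dual ℂ M.carrier), extend_mem_dualDeg M d ξ⟩
        map_add' := fun _ _ => rfl
        map_smul' := fun _ _ => rfl }
      (by
        ext ξ m
        change ξ ⟨M.proj (-d) m, _⟩ = ξ m
        exact congrArg ξ (Subtype.ext (M.proj_of_mem m.2)))
      (by
        refine LinearMap.ext fun f => Subtype.ext (M.ext_deg fun j m hm => ?_)
        change (show Module.Dual ℂ M.carrier from f.1) (M.proj (-d) m) =
          (show Module.Dual ℂ M.carrier from f.1) m
        by_cases h : j = -d
        · subst h
          rw [M.proj_of_mem hm]
        · rw [M.proj_of_mem_ne h hm, map_zero]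
          exact (f.2 j h m hm).symm))
    (fun w => by
      refine LinearMap.ext fun f => LinearMap.ext fun m => ?_
      refine (single_smul_dual M w 1 f.1 m.1).trans ?_
      rw [smul_one]
      rfl)

/-- Here self-duality of representations enters: degree `d` of the dual is the dual of `M_{-d}`,
which as a representation is `M_{-d}` again. -/
theorem finrank_multSpace_dual (M : SkewMod W n) [FiniteDimensional ℂ M.carrier] (d : ℤ)
    (h : Nonempty ((degRep M (-d)).Equiv (degRep M (-d)).dual)) :
    Module.finrank ℂ (multSpace ρ (dualModule M) d) =
      Module.finrank ℂ (multSpace ρ M (-d)) := by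
  obtain ⟨φ⟩ := h
  rw [(multSpaceEquiv ρ _ d).finrank_eq, (multSpaceEquiv ρ _ (-d)).finrank_eq]
  exact finrank_intertwiningMap_congr ρ ((dualDegEquiv M d).trans φ.symm)

theorem dualModule_isLE {M : SkewMod W n} [FiniteDimensional ℂ M.carrier] (hM : M.IsGE 0) :
    (dualModule M).IsLE 0 := by
  intro i hi
  refine (Submodule.eq_bot_iff (dualDeg M i)).2 fun f hf => ?_
  refine M.ext_deg fun j m hm => ?_
  by_cases h : j = -i
  · rw [hM j (by omega), Submodule.mem_bot] at hm
    rw [hm, map_zero, map_zero]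
  · exact hf j h m hm

end mult

end skew

namespace GrMod

variable {k : Type uk} {A : Type uA} [Field k] [Ring A] [Algebra k A] {𝒜 : ℤ → Submodule k A}
  [IsNoetherianRing A]

/-- If a step of a filtration of `M` is all of `M`, then the factor is a quotient of `M`. -/
theorem Filtration.exists_factorMap {M : GrMod 𝒜} (Φ : Filtration M) {i : ℕ}
    (h : (Φ.step i).toSubmodule = ⊤) : ∃ q : M ⟶ Φ.factor i, Function.Surjective (lin q) ∧
      ∀ x, lin q x = 0 ↔ x ∈ (Φ.step (i + 1)).toSubmodule := by
  have hi : ∀ x, x ∈ (Φ.step i).toSubmodule := fun x => by rw [h]; trivial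
  let u : M ⟶ M.sub (Φ.step i) := Hom.mk (M := M) (N := M.sub (Φ.step i))
    (LinearMap.id.codRestrict (Φ.step i).toSubmodule hi) fun _ _ hm => hm
  refine ⟨u ≫ mkQ _ _, fun y => ?_, fun x => ?_⟩
  · obtain ⟨x, rfl⟩ := mkQ_surjective _ _ y
    exact ⟨x.1, rfl⟩
  · exact mkQ_eq_zero_iff (M := M.sub (Φ.step i))
      (L := (Φ.step (i + 1)).comap (M.subtype (Φ.step i)))

end GrMod

section skew

variable {W : Type uA} [Group W] {n : ℕ} [MulSemiringAction W (PolyRing n)]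
  [SMulCommClass W ℂ (PolyRing n)] [PreservesDegree W n]

open SkewMonoidAlgebra (single)

/-! ## Trace quotient modules -/

/-- The generators sit in degree `d`, where `T` vanishes. -/
theorem proj_hom_eq_zero {V : Type} [AddCommGroup V] [Module ℂ V] [FiniteDimensional ℂ V]
    (ρ : Representation ℂ W V) {T : SkewMod W n} {d : ℤ} (hT : T.IsGE (d + 1))
    (f : (projModule (n := n) ρ).shift d ⟶ T) : f = 0 := by
  refine projModule_hom_ext ρ fun v => ?_
  have := (comp_mem_multSpace ρ f (genMap_mem ρ d)).1 v
  rw [hT d (by omega), Submodule.mem_bot] at this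
  exact this

theorem PMod_isGE (l : Irr W) : (PMod n l).IsGE 0 := projModule_isGE l.rep.ρ

theorem PMod_hom_eq_zero (l : Irr W) {T : SkewMod W n} (hT : T.IsGE 1) (f : PMod n l ⟶ T) :
    f = 0 := by
  have : (PMod n l).shiftZero.hom ≫ f = 0 := proj_hom_eq_zero l.rep.ρ (by simpa using hT) _
  rw [← cancel_epi (PMod n l).shiftZero.hom, this, comp_zero]

theorem range_le_traceSub {T : Set (Irr W)} {l m : Irr W} (hm : m ∈ T) {d : ℤ} (hd : 0 < d)
    (f : (PMod n m).shift d ⟶ PMod n l) (x : ((PMod n m).shift d).carrier) :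
    GrMod.lin f x ∈ (traceSub n T l).toSubmodule :=
  Submodule.mem_iSup_of_mem (⟨⟨m, hm⟩, ⟨d, hd⟩, f⟩ :
    Σ m : T, Σ d : {d : ℤ // 0 < d}, ((PMod n m.1).shift d.1 ⟶ PMod n l)) ⟨x, rfl⟩

/-- The trace submodule is a sum of images of modules `P_m⟨d⟩` with `d > 0`, all of which start in
degree `d`. -/
theorem proj_eq_zero_of_mem_traceSub {T : Set (Irr W)} {l : Irr W} {x : (PMod n l).carrier}
    (hx : x ∈ (traceSub n T l).toSubmodule) {i : ℤ} (hi : i < 1) : (PMod n l).proj i x = 0 := by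
  induction hx using Submodule.iSup_induction' with
  | mem y x hx =>
    obtain ⟨x, rfl⟩ := hx
    obtain ⟨m, ⟨d, hd⟩, f⟩ := y
    have h := GrMod.proj_mem ((PMod n m.1).shift d) i x
    rw [(PMod_isGE m.1).shift d i (by omega), Submodule.mem_bot] at h
    change (PMod n l).proj i (GrMod.lin f x) = 0
    rw [← GrMod.lin_proj, h, map_zero]
  | zero => exact map_zero _
  | add x y _ _ hx hy => rw [map_add, hx, hy, add_zero]

/-- A homomorphism out of the trace submodule that vanishes on all homomorphisms from the `P_m`
vanishes. -/
theorem hom_traceSub_ext [Finite W] {T : Set (Irr W)} {l : Irr W} {X : SkewMod W n}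
    (f : (PMod n l).sub (traceSub n T l) ⟶ X)
    (h : ∀ m ∈ T, ∀ d > 0, ∀ u : (PMod n m).shift d ⟶ (PMod n l).sub (traceSub n T l),
      u ≫ f = 0) : f = 0 := by
  have key : ∀ x, ∀ hx : x ∈ (traceSub n T l).toSubmodule, GrMod.lin f ⟨x, hx⟩ = 0 := by
    intro x hx
    have hx' := hx
    induction hx' using Submodule.iSup_induction' with
    | mem y x hx' =>
      obtain ⟨x, rfl⟩ := hx'
      obtain ⟨m, ⟨d, hd⟩, u⟩ := y
      -- The image of `u` is one of the summands that define the trace submodule, so `u` factors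
      -- through it.
      obtain ⟨u', hu'⟩ := GrMod.exists_lift ((PMod n l).subtype (traceSub n T l))
        (traceSub n T l).toSubmodule.subtype_injective u
        fun t => ⟨⟨_, range_le_traceSub m.2 hd u t⟩, rfl⟩
      have e : GrMod.lin u' x = ⟨GrMod.lin u x, hx⟩ :=
        Subtype.ext (LinearMap.congr_fun (congrArg GrMod.lin hu') x)
      have := LinearMap.congr_fun (congrArg GrMod.lin (h m.1 m.2 d hd u')) x
      change GrMod.lin f (GrMod.lin u' x) = 0 at this
      rwa [e] at this
    | zero => exact map_zero _
    | add x y hx₁ hy₁ ihx ihy =>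
      have := (GrMod.lin f).map_add ⟨x, hx₁⟩ ⟨y, hy₁⟩
      rw [ihx hx₁, ihy hy₁, add_zero] at this
      exact this
  exact GrMod.hom_ext fun x => key x.1 x.2

theorem traceSub_isGE [Finite W] (T : Set (Irr W)) (l : Irr W) :
    ((PMod n l).sub (traceSub n T l)).IsGE 1 := by
  intro i hi
  refine (Submodule.eq_bot_iff _).2 fun x hx => Subtype.ext ?_
  have h : (PMod n l).proj i x.1 = x.1 := (PMod n l).proj_of_mem hx
  rw [← h]
  exact proj_eq_zero_of_mem_traceSub x.2 hi

/-- The trace quotient of `P_l` with respect to a set `T`. -/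
abbrev traceQuot (T : Set (Irr W)) (l : Irr W) : SkewMod W n := (PMod n l).quot (traceSub n T l)

theorem traceQuot_isGE (T : Set (Irr W)) (l : Irr W) : (traceQuot (n := n) T l).IsGE 0 :=
  (PMod_isGE l).quot _

/-- The generators of a trace quotient module. -/
def quotGen (T : Set (Irr W)) (l : Irr W) : l.rep.V →ₗ[ℂ] (traceQuot (n := n) T l).carrier :=
  (GrMod.lin ((PMod n l).mkQ (traceSub n T l))).restrictScalars ℂ ∘ₗ genMap l.rep.ρ

theorem genMap_mem_zero (l : Irr W) (v : l.rep.V) :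
    (show (PMod n l).carrier from genMap l.rep.ρ v) ∈ (PMod n l).deg 0 :=
  tmul_mem_tensorDeg (MvPolynomial.isHomogeneous_one _ _) v

theorem quotGen_mem (T : Set (Irr W)) (l : Irr W) :
    quotGen (n := n) T l ∈ multSpace l.rep.ρ (traceQuot (n := n) T l) 0 := by
  have := comp_mem_multSpace l.rep.ρ ((PMod n l).mkQ (traceSub n T l))
    (f := genMap l.rep.ρ) (d := 0)
    ⟨fun v => genMap_mem_zero l v, (genMap_mem (n := n) l.rep.ρ 0).2⟩
  exact this

/-- Evaluating polynomials at the origin gives a left inverse. -/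
theorem genMap_injective {V : Type} [AddCommGroup V] [Module ℂ V] [FiniteDimensional ℂ V]
    (ρ : Representation ℂ W V) : Function.Injective (genMap (n := n) ρ) := by
  have : ∀ v : V, TensorProduct.lid ℂ V (LinearMap.rTensor V
      (MvPolynomial.aeval (R := ℂ) (fun _ : Fin n => (0 : ℂ))).toLinearMap
      (show PolyRing n ⊗[ℂ] V from genMap ρ v)) = v := by
    intro v
    change TensorProduct.lid ℂ V (LinearMap.rTensor V _ ((1 : PolyRing n) ⊗ₜ[ℂ] v)) = v
    rw [LinearMap.rTensor_tmul]
    simp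
  exact Function.LeftInverse.injective (g := fun x => TensorProduct.lid ℂ V (LinearMap.rTensor V
      (MvPolynomial.aeval (R := ℂ) (fun _ : Fin n => (0 : ℂ))).toLinearMap x)) this

theorem exists_genMap_of_mem (l : Irr W) {x : (PMod n l).carrier} (hx : x ∈ (PMod n l).deg 0) :
    ∃ v : l.rep.V, (show (PMod n l).carrier from genMap l.rep.ρ v) = x := by
  have : tensorDeg n l.rep.V 0 ≤ LinearMap.range (TensorProduct.mk ℂ (PolyRing n) l.rep.V 1) := by
    refine tensorDeg_le fun p hp v => ⟨p.coeff 0 • v, ?_⟩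
    have h : MvPolynomial.homogeneousComponent 0 p = p := polyProj_of_mem 0 p hp
    rw [MvPolynomial.homogeneousComponent_zero] at h
    rw [TensorProduct.mk_apply, ← TensorProduct.smul_tmul, MvPolynomial.smul_eq_C_mul, mul_one, h]
  exact this hx

/-- The part of degree zero of a trace quotient of `P_l` is `l`. -/
def quotGenEquiv [Finite W] (T : Set (Irr W)) (l : Irr W) :
    l.rep.ρ.Equiv (degRep (traceQuot (n := n) T l) 0) :=
  Representation.Equiv.mk
    (LinearEquiv.ofBijective
      ((quotGen T l).codRestrict ((traceQuot (n := n) T l).deg 0) (quotGen_mem T l).1) (by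
      constructor
      · rw [injective_iff_map_eq_zero]
        intro v hv
        have hv' : (show (PMod n l).carrier from genMap l.rep.ρ v) ∈
          (traceSub n T l).toSubmodule := GrMod.mkQ_eq_zero_iff.1 (congrArg Subtype.val hv)
        have h := proj_eq_zero_of_mem_traceSub hv' zero_lt_one
        rw [(PMod n l).proj_of_mem (genMap_mem_zero l v)] at h
        exact genMap_injective (n := n) l.rep.ρ (h.trans (map_zero _).symm)
      · rintro ⟨_, x, hx, rfl⟩
        obtain ⟨v, rfl⟩ := exists_genMap_of_mem l hx
        exact ⟨v, rfl⟩))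
    (fun w => LinearMap.ext fun v => Subtype.ext ((quotGen_mem T l).2 w v))

/-- Schur's lemma; representatives of distinct classes are not isomorphic. -/
theorem finrank_intertwiningMap_rep [DecidableEq (Irr W)] (l m : Irr W) :
    Module.finrank ℂ (Representation.IntertwiningMap l.rep.ρ m.rep.ρ) = if l = m then 1 else 0 := by
  have := l.rep.irreducible
  have := m.rep.irreducible
  split_ifs with h
  · subst h
    exact Representation.IsIrreducible.finrank_intertwiningMap_self _
  · have : IsEmpty (l.rep.ρ.Equiv m.rep.ρ) := ⟨fun e => h (Quotient.out_equiv_out.1 ⟨e⟩)⟩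
    exact Module.finrank_zero_of_subsingleton

theorem finrank_multSpace_traceQuot_zero [Finite W] [DecidableEq (Irr W)] (T : Set (Irr W))
    (l m : Irr W) : Module.finrank ℂ (multSpace l.rep.ρ (traceQuot (n := n) T m) 0) =
      if l = m then 1 else 0 := by
  rw [(multSpaceEquiv _ _ _).finrank_eq, ← finrank_intertwiningMap_rep,
    finrank_intertwiningMap_congr _ (quotGenEquiv (n := n) T m)]

instance [Finite W] (l : Irr W) (d : ℤ) : Projective ((PMod n l).shift d) :=
  projModule_projective l.rep.ρ d

instance [Finite W] (l : Irr W) : Projective (PMod n l) :=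
  Projective.of_iso (PMod n l).shiftZero inferInstance

/-- By projectivity the map lifts to `P_l`, and there its image lies in the trace submodule by
construction. -/
theorem hom_traceQuot_eq_zero [Finite W] {T : Set (Irr W)} {l m : Irr W} (hm : m ∈ T) {d : ℤ}
    (hd : 0 < d) (f : (PMod n m).shift d ⟶ traceQuot T l) : f = 0 := by
  have := GrMod.epi_of_surjective _ (GrMod.mkQ_surjective (PMod n l) (traceSub n T l))
  rw [← Projective.factorThru_comp f ((PMod n l).mkQ (traceSub n T l))]
  exact GrMod.hom_ext fun x => GrMod.mkQ_eq_zero_iff.2 (range_le_traceSub hm hd _ x)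

theorem gradedMult_KMod_zero [Finite W] [Preorder (Irr W)] [DecidableEq (Irr W)] (l m : Irr W) :
    gradedMult (KMod n m) l 0 = if l = m then 1 else 0 :=
  finrank_multSpace_traceQuot_zero _ l m

/-- In positive degree the trace quotient admits no map from `P_l` with `m ≤ l`. Because the
preorder need not be total, `¬ m ≤ l` falls short of `l < m`; closing this gap is part of the
induction in `orthogonal`. -/
theorem of_gradedMult_KMod_ne_zero [Finite W] [Preorder (Irr W)] {l m : Irr W} {d : ℤ}
    (h : gradedMult (KMod n m) l d ≠ 0) : d = 0 ∧ l = m ∨ 0 < d ∧ ¬ m ≤ l := by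
  classical
  rcases lt_trichotomy d 0 with hd | hd | hd
  · refine absurd ?_ h
    refine (projHomEquiv (n := n) l.rep.ρ (KMod n m) d).finrank_eq.symm.trans ?_
    have : Subsingleton ((projModule (n := n) l.rep.ρ).shift d ⟶ KMod n m) :=
      subsingleton_of_forall_eq 0 fun f => ?_
    · exact Module.finrank_zero_of_subsingleton
    refine projModule_hom_ext _ fun v => ?_
    have := (comp_mem_multSpace l.rep.ρ f (genMap_mem l.rep.ρ d)).1 v
    have hbot : (KMod n m).deg d = ⊥ := traceQuot_isGE (n := n) {x | m ≤ x} m d hd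
    rw [hbot, Submodule.mem_bot] at this
    exact this
  · subst hd
    refine Or.inl ⟨rfl, ?_⟩
    by_contra hlm
    rw [gradedMult_KMod_zero, if_neg hlm] at h
    exact h rfl
  · refine Or.inr ⟨hd, fun hml => h ?_⟩
    refine (projHomEquiv (n := n) l.rep.ρ (KMod n m) d).finrank_eq.symm.trans ?_
    have : Subsingleton ((projModule (n := n) l.rep.ρ).shift d ⟶ KMod n m) :=
      subsingleton_of_forall_eq 0 fun f =>
        hom_traceQuot_eq_zero (T := {x | m ≤ x}) (l := m) (m := l) hml hd f
    exact Module.finrank_zero_of_subsingleton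

theorem not_isGE_traceQuot [Finite W] (T : Set (Irr W)) (l : Irr W) :
    ¬ (traceQuot (n := n) T l).IsGE 1 := by
  classical
  intro h
  have h1 := finrank_multSpace_traceQuot_zero (n := n) T l l
  rw [if_pos rfl] at h1
  have : Subsingleton (multSpace l.rep.ρ (traceQuot (n := n) T l) 0) :=
    subsingleton_of_forall_eq 0 fun f => Subtype.ext (LinearMap.ext fun v => by
      have := f.2.1 v
      rw [h 0 zero_lt_one, Submodule.mem_bot] at this
      exact this)
  rw [Module.finrank_zero_of_subsingleton] at h1
  exact zero_ne_one h1

theorem KMod_isGE [Preorder (Irr W)] (m : Irr W) : (KMod n m).IsGE 0 := traceQuot_isGE (n := n) {x | m ≤ x} m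

theorem epi_mkQ [Preorder (Irr W)] (l : Irr W) : Epi (show PMod n l ⟶ KtMod n l from (PMod n l).mkQ _) :=
  GrMod.epi_of_surjective _ (GrMod.mkQ_surjective _ _)

theorem subsingleton_ext_KtMod_of_sub [Finite W] [Preorder (Irr W)] {X : SkewMod W n} (l : Irr W) (i : ℕ)
    (h : Subsingleton (Abelian.Ext ((PMod n l).sub (traceSub n {m | l < m} l)) X i)) :
    Subsingleton (Abelian.Ext (KtMod n l) X (i + 1)) := by
  have : Projective ((PMod n l).subComplex (traceSub n {m | l < m} l)).X₂ :=
    inferInstanceAs (Projective (PMod n l))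
  exact Abelian.Ext.subsingleton_right
    ((PMod n l).subComplex_shortExact (traceSub n {m | l < m} l)) X i h

/-! ### The filtration of `P_l` -/

/-- A filtration of `P_l` by the strict trace quotients induces one of the kernel of `P_l → K̃_l`
with factors in positive degrees. -/
theorem exists_traceSub_filtration [Finite W] [Preorder (Irr W)] {l : Irr W}
    (h : (PMod n l).IsFilteredWithMultiplicity (KtMod n) (fun m d => gradedMult (KMod n m) l d)) :
    ∃ (Φ : GrMod.Filtration (PMod n l)) (j : ℕ),
      Φ.step j = traceSub n {m | l < m} l ∧
      (∀ i ≥ j, IsZero (Φ.factor i) ∨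
        ∃ a d, 0 < d ∧ Nonempty (Φ.factor i ≅ (KtMod n a).shift d)) ∧
      (∀ m e, 0 < e → {i | j ≤ i ∧ Nonempty (Φ.factor i ≅ (KtMod n m).shift e)}.encard =
        gradedMult (KMod n m) l e) ∧
      ∀ c, ∃ j₀, ∀ i ≥ j₀, ((PMod n l).sub (Φ.step i)).IsGE c := by
  classical
  obtain ⟨Φ, ⟨hsep, hfac⟩, hmult⟩ := h
  -- A factor that occurs has nonzero prescribed multiplicity, so its shift is positive or it is
  -- `K̃_l` unshifted.
  have hpos : ∀ i a d, Nonempty (Φ.factor i ≅ (KtMod n a).shift d) → d = 0 ∧ l = a ∨ 0 < d := by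
    intro i a d hi
    have : gradedMult (KMod n a) l d ≠ 0 := by
      intro h0
      have : Φ.multiplicity ((KtMod n a).shift d) = (gradedMult (KMod n a) l d : ℕ) := hmult a d
      rw [h0, Nat.cast_zero, GrMod.Filtration.multiplicity, Set.encard_eq_zero] at this
      exact (this.subset hi : i ∈ (∅ : Set ℕ))
    exact (of_gradedMult_KMod_ne_zero this).imp id And.left
  -- `P_l` is generated in degree zero, so it has no nonzero quotient that starts in a positive
  -- degree.
  have hKt : ∀ a d, 0 < d → ∀ q : PMod n l ⟶ (KtMod n a).shift d,
      ¬ Function.Surjective (GrMod.lin q) := by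
    intro a d hd q hq
    have hge : ((KtMod n a).shift d).IsGE d := by
      have := (traceQuot_isGE (n := n) {m | a < m} a).shift d
      rwa [zero_add] at this
    have h0 : q = 0 := PMod_hom_eq_zero l (hge.mono (by omega)) q
    refine not_isGE_traceQuot (n := n) {m | a < m} a fun i _ => (Submodule.eq_bot_iff _).2
      fun x _ => ?_
    obtain ⟨y, hy⟩ := hq x
    rw [h0] at hy
    exact hy.symm
  have hex : ∃ j, (Φ.step (j + 1)).toSubmodule ≠ ⊤ := by
    by_contra! hall
    have htop : ⨅ i, (Φ.step i).toSubmodule = ⊤ := by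
      refine iInf_eq_top.2 fun i => ?_
      cases i with
      | zero => exact Φ.step_zero
      | succ i => exact hall i
    rw [hsep] at htop
    -- Otherwise `P_l = 0`. Any trace quotient of `P_l` gives the contradiction, since its
    -- degree-zero part is `l`.
    refine not_isGE_traceQuot (n := n) ∅ l ?_
    refine GrMod.IsGE.quot (fun i _ => (Submodule.eq_bot_iff _).2 fun x _ => ?_) _
    rw [← Submodule.mem_bot (SkewAlg W n), htop]
    trivial
  have hj := Nat.find_spec hex
  have hmin : ∀ i ≤ Nat.find hex, (Φ.step i).toSubmodule = ⊤ := by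
    intro i hi
    cases i with
    | zero => exact Φ.step_zero
    | succ i => exact not_not.1 (Nat.find_min hex hi)
  generalize Nat.find hex = j at hj hmin
  -- Step `j` is still all of `P_l`, so factor `j` is a nonzero quotient of `P_l`, and this forces
  -- it to be `K̃_l` unshifted.
  have hstep : (Φ.step (j + 1)).toSubmodule = (traceSub n {m | l < m} l).toSubmodule := by
    obtain ⟨q, hq, hker⟩ := Φ.exists_factorMap (hmin j le_rfl)
    have hnz : ¬ IsZero (Φ.factor j) := by
      intro hz
      refine hj (eq_top_iff.2 fun x _ => (hker x).1 ?_)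
      rw [hz.eq_of_tgt q 0]
      rfl
    obtain ⟨a, d, ⟨e⟩⟩ := (hfac j).resolve_left hnz
    have hsurj : Function.Surjective (GrMod.lin (q ≫ e.hom)) :=
      (GrMod.surjective_of_epi e.hom).comp hq
    rcases hpos j a d ⟨e⟩ with ⟨rfl, rfl⟩ | hd
    · let r : PMod n l ⟶ KtMod n l := (q ≫ e.hom) ≫ (KtMod n l).shiftZero.hom
      have hr : Function.Surjective (GrMod.lin r) :=
        (GrMod.surjective_of_epi (KtMod n l).shiftZero.hom).comp hsurj
      have hrker : ∀ x, GrMod.lin r x = 0 ↔ x ∈ (Φ.step (j + 1)).toSubmodule := by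
        intro x
        rw [← hker]
        exact (injective_iff_map_eq_zero' (GrMod.lin (e.hom ≫ (KtMod n l).shiftZero.hom))).1
          (GrMod.injective_of_mono _) _
      have hle : ∀ x ∈ (traceSub n {m | l < m} l).toSubmodule, GrMod.lin r x = 0 := by
        intro x hx
        have : (PMod n l).subtype (traceSub n {m | l < m} l) ≫ r = 0 :=
          hom_traceSub_ext _ fun m hm d hd u =>
            hom_traceQuot_eq_zero (T := {m | l < m}) hm hd
              (u ≫ (PMod n l).subtype (traceSub n {m | l < m} l) ≫ r)
        exact LinearMap.congr_fun (congrArg GrMod.lin this) ⟨x, hx⟩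
      obtain ⟨s, hs⟩ := GrMod.exists_desc ((PMod n l).mkQ (traceSub n {m | l < m} l))
        (GrMod.mkQ_surjective _ _) r fun x hx => hle x (GrMod.mkQ_eq_zero_iff.1 hx)
      have hs' : ∀ x, GrMod.lin s (GrMod.lin ((PMod n l).mkQ (traceSub n {m | l < m} l)) x) =
        GrMod.lin r x := fun x => LinearMap.congr_fun (congrArg GrMod.lin hs) x
      have hsur : Function.Surjective
          (show (KtMod n l).carrier →ₗ[SkewAlg W n] (KtMod n l).carrier from GrMod.lin s) := by
        intro y
        obtain ⟨x, hx⟩ := hr y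
        exact ⟨_, (hs' x).trans hx⟩
      -- The map `r` kills the trace submodule and so induces a surjective endomorphism of the
      -- Noetherian module `K̃_l`. Its injectivity identifies the kernel of `r` with the trace
      -- submodule.
      have hinj := IsNoetherian.injective_of_surjective_endomorphism _ hsur
      ext x
      rw [← hrker, ← hs', ← GrMod.mkQ_eq_zero_iff]
      exact (injective_iff_map_eq_zero' _).1 hinj _
    · exact absurd hsurj (hKt a d hd _)
  have hge : ∀ i ≥ j + 1, ((PMod n l).sub (Φ.step i)).IsGE 1 := by
    intro i hi
    have hle : (Φ.step i).toSubmodule ≤ (traceSub n {m | l < m} l).toSubmodule :=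
      (Φ.antitone hi).trans hstep.le
    exact (traceSub_isGE {m | l < m} l).of_injective (GrMod.inclusion hle)
      (Submodule.inclusion_injective hle)
  refine ⟨Φ, j + 1, GrMod.GrSub.ext hstep, fun i hi => (hfac i).imp id ?_, fun m e he => ?_,
    fun c => Φ.exists_isGE hsep (PMod_isGE l) (projModule_deg_finite l.rep.ρ) c⟩
  · rintro ⟨a, d, ⟨u⟩⟩
    refine ⟨a, d, (hpos i a d ⟨u⟩).resolve_left ?_, ⟨u⟩⟩
    rintro ⟨rfl, rfl⟩
    -- An unshifted `K̃_l` is nonzero in degree zero, but past the first proper step everything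
    -- lives in degrees at least `1`.
    refine not_isGE_traceQuot (n := n) {m | l < m} l ?_
    have h1 : (Φ.factor i).IsGE 1 := (hge i hi).quot _
    let v : KtMod n l ≅ Φ.factor i := (KtMod n l).shiftZero.symm.trans u.symm
    exact h1.of_injective (M := KtMod n l) v.hom (GrMod.injective_of_mono v.hom)
  · rw [← hmult m e, GrMod.Filtration.multiplicity]
    congr 1
    ext i
    refine ⟨And.right, fun hi => ⟨?_, hi⟩⟩
    -- An earlier factor is a quotient of `P_l`, which `hKt` excludes for `e > 0`. Hence discarding
    -- the initial steps loses no factor with positive shift.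
    by_contra hlt
    obtain ⟨q, hq, -⟩ := Φ.exists_factorMap (hmin i (by omega))
    obtain ⟨u⟩ := hi
    exact hKt m e he (q ≫ u.hom) ((GrMod.surjective_of_epi u.hom).comp hq)

end skew

section skew

variable {W : Type uA} [Group W] {n : ℕ} [MulSemiringAction W (PolyRing n)]
  [SMulCommClass W ℂ (PolyRing n)] [PreservesDegree W n]

open SkewMonoidAlgebra (single)

/-! ## Duals of trace quotient modules -/

/-- All finite-dimensional representations of `W` are self-dual. -/
def SelfDual (W : Type uA) [Group W] : Prop :=
  ∀ (V : Type) [AddCommGroup V] [Module ℂ V] [FiniteDimensional ℂ V]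
    (ρ : Representation ℂ W V), Nonempty (ρ.Equiv ρ.dual)

variable [FiniteDimensional ℂ (PolyRing n ⧸ invariantIdeal W n)] [Preorder (Irr W)]

variable (n) in
/-- The shift `K_m^*⟨e⟩` of the dual of `K_m`. -/
abbrev DMod (m : Irr W) (e : ℤ) : SkewMod W n := (dualModule (KMod n m)).shift e

theorem DMod_isLE (m : Irr W) (e : ℤ) : (DMod n m e).IsLE e := by
  have := (dualModule_isLE (KMod_isGE (n := n) m)).shift e
  rwa [zero_add] at this

/-- The maps are the equivariant maps from `l` to degree `d - e` of `K_m^*`; self-duality replaces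
that part by degree `e - d` of `K_m`. -/
theorem finrank_hom_DMod (hW : SelfDual W) (l m : Irr W) (d e : ℤ) :
    Module.finrank ℂ ((PMod n l).shift d ⟶ DMod n m e) = gradedMult (KMod n m) l (e - d) := by
  rw [← neg_sub d e]
  exact (projHomEquiv l.rep.ρ (DMod n m e) d).finrank_eq.trans
    (finrank_multSpace_dual l.rep.ρ (KMod n m) (d - e) (hW _ _))

instance (l m : Irr W) (d e : ℤ) : FiniteDimensional ℂ ((PMod n l).shift d ⟶ DMod n m e) := by
  have : FiniteDimensional ℂ (DMod n m e).carrier :=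
    inferInstanceAs (FiniteDimensional ℂ (Module.Dual ℂ (KMod n m).carrier))
  exact Module.Finite.equiv (projHomEquiv (n := n) l.rep.ρ (DMod n m e) d).symm

theorem PMod_shift_hom_DMod_eq_zero (hW : SelfDual W) {l m : Irr W} {d e : ℤ}
    (h : gradedMult (KMod n m) l (e - d) = 0) (f : (PMod n l).shift d ⟶ DMod n m e) : f = 0 := by
  rw [← finrank_hom_DMod hW] at h
  exact (Module.finrank_zero_iff.1 h).elim _ _

/-- A nonzero homomorphism to `K_m^*⟨e⟩` is detected on the generators of `K_m`. -/
theorem exists_apply_quotGen_ne_zero {T : SkewMod W n} {m : Irr W} {e : ℤ} {f : T ⟶ DMod n m e}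
    (hf : f ≠ 0) : ∃ (t : T.carrier) (v : m.rep.V),
      (show Module.Dual ℂ (KMod n m).carrier from GrMod.lin f t) (quotGen {x | m ≤ x} m v) ≠ 0 := by
  by_contra! h
  refine hf (GrMod.hom_ext fun t => ?_)
  refine LinearMap.ext (R := ℂ) (M := (KMod n m).carrier) fun x => ?_
  obtain ⟨y, rfl⟩ := GrMod.mkQ_surjective (PMod n m) (traceSub n {x | m ≤ x} m) x
  have hy : y ∈ Submodule.span (SkewAlg W n) (Set.range (genMap (n := n) m.rep.ρ)) := by
    rw [span_genMap]
    trivial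
  induction hy using Submodule.span_induction generalizing t with
  | mem y hy =>
    obtain ⟨v, rfl⟩ := hy
    exact h t v
  | zero => rw [map_zero]; exact map_zero _
  | add y z _ _ hy hz =>
    rw [map_add]
    refine ((show Module.Dual ℂ (KMod n m).carrier from GrMod.lin f t).map_add _ _).trans ?_
    rw [hy t, hz t]
    exact add_zero _
  | smul a y _ hy =>
    rw [map_smul]
    generalize GrMod.lin ((PMod n m).mkQ (traceSub n {x | m ≤ x} m)) y = z at hy
    induction a using SkewMonoidAlgebra.induction_on' with
    | single w s =>
      -- The action on the dual moves a scalar from the argument of the functional to `t`, and the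
      -- induction hypothesis holds for every `t`.
      have := single_smul_dual (KMod n m) w⁻¹ (w⁻¹ • s) (GrMod.lin f t) z
      rw [inv_inv, smul_inv_smul] at this
      refine this.symm.trans ?_
      have h2 := hy ((single w⁻¹ (w⁻¹ • s) : SkewAlg W n) • t)
      rw [map_smul] at h2
      exact h2
    | add a b ha hb =>
      rw [add_smul]
      refine ((show Module.Dual ℂ (KMod n m).carrier from GrMod.lin f t).map_add _ _).trans ?_
      rw [ha, hb]
      exact add_zero _

/-- The generators of `K_m` have degree zero, and only functionals of degree `e` in `K_m^*⟨e⟩` can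
be nonzero on them. -/
theorem exists_deg_apply_ne_zero {T : SkewMod W n} {m : Irr W} {e : ℤ} {f : T ⟶ DMod n m e}
    (hf : f ≠ 0) : ∃ t ∈ T.deg e, GrMod.lin f t ≠ 0 := by
  obtain ⟨t, v, h⟩ := exists_apply_quotGen_ne_zero hf
  obtain ⟨s, hs⟩ := T.exists_sum_proj t
  by_contra! h0
  refine h ?_
  rw [hs, map_sum]
  refine (LinearMap.sum_apply (R := ℂ) (R₂ := ℂ) s _ _).trans (Finset.sum_eq_zero fun i _ => ?_)
  by_cases hi : i = e
  · subst hi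
    rw [h0 _ (T.proj_mem i t)]
    rfl
  · exact f.map_deg i _ (T.proj_mem i t) 0 (by omega) _ ((quotGen_mem {x | m ≤ x} m).1 v)

variable [Finite W]

/-- The module `K_m^*⟨e⟩` has a simple socle `m` in degree `e`. -/
theorem exists_hom_ne_zero (hW : SelfDual W) {T : SkewMod W n} {m : Irr W} {e : ℤ}
    {f : T ⟶ DMod n m e} (hf : f ≠ 0) : ∃ h : (PMod n m).shift e ⟶ T, h ≠ 0 := by
  classical
  obtain ⟨t, ht, hft⟩ := exists_deg_apply_ne_zero hf
  -- The map `g` chosen below spans this line. It identifies `m` with the whole degree-`e` part of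
  -- `K_m^*⟨e⟩`, by irreducibility and equality of dimensions.
  have h1 : Module.finrank ℂ ((PMod n m).shift e ⟶ DMod n m e) = 1 := by
    rw [finrank_hom_DMod hW, sub_self, gradedMult_KMod_zero, if_pos rfl]
  have : Nontrivial ((PMod n m).shift e ⟶ DMod n m e) :=
    Module.nontrivial_of_finrank_pos (R := ℂ) (by omega)
  obtain ⟨g, hg⟩ := exists_ne (0 : (PMod n m).shift e ⟶ DMod n m e)
  have hgm := comp_mem_multSpace m.rep.ρ g (genMap_mem m.rep.ρ e)
  have hinj := (multSpace_injective_or_eq_zero m hgm).resolve_right fun h0 =>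
    hg (projModule_hom_ext m.rep.ρ fun v => LinearMap.congr_fun h0 v)
  have hdim : Module.finrank ℂ m.rep.V = Module.finrank ℂ ((DMod n m e).deg e) := by
    have e1 := (dualDegEquiv (KMod n m) (e - e)).toLinearEquiv.finrank_eq
    rw [Subspace.dual_finrank_eq, sub_self, neg_zero] at e1
    refine (quotGenEquiv (n := n) {x | m ≤ x} m).toLinearEquiv.finrank_eq.trans ?_
    change _ = Module.finrank ℂ ((dualModule (KMod n m)).deg (e - e))
    rw [sub_self]
    exact e1.symm
  have : FiniteDimensional ℂ (DMod n m e).carrier :=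
    inferInstanceAs (FiniteDimensional ℂ (Module.Dual ℂ (KMod n m).carrier))
  have hsurj := (LinearMap.injective_iff_surjective_of_finrank_eq_finrank hdim
    (f := LinearMap.codRestrict ((DMod n m e).deg e) _ hgm.1)).1
    fun x y hxy => hinj (congrArg Subtype.val hxy)
  obtain ⟨v, hv⟩ := hsurj ⟨GrMod.lin f t, f.map_deg e t ht⟩
  have hv' : GrMod.lin g (genMap m.rep.ρ v : (projModule (n := n) m.rep.ρ).carrier) =
    GrMod.lin f t := congrArg Subtype.val hv
  -- The image of `f` contains the nonzero vector `f(t) = g(v)`. As `m` is irreducible, the induced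
  -- map from `m` to the quotient by that image is then zero.
  have hπ : g ≫ (DMod n m e).mkQ (GrMod.range f) = 0 := by
    refine projModule_hom_ext m.rep.ρ fun u => ?_
    have h2 := comp_mem_multSpace m.rep.ρ ((DMod n m e).mkQ (GrMod.range f)) hgm
    refine LinearMap.congr_fun ((multSpace_injective_or_eq_zero m h2).resolve_left fun hi => ?_) u
    have hv0 : v = 0 := hi (by
      rw [map_zero]
      refine GrMod.mkQ_eq_zero_iff.2 ⟨t, hv'.symm⟩)
    rw [hv0, map_zero] at hv'
    exact hft (hv'.symm.trans (map_zero (GrMod.lin g)))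
  obtain ⟨g', hg'⟩ := GrMod.exists_lift ((DMod n m e).subtype (GrMod.range f))
    (GrMod.range f).toSubmodule.subtype_injective g fun x =>
      ⟨⟨_, GrMod.mkQ_eq_zero_iff.1 (LinearMap.congr_fun (congrArg GrMod.lin hπ) x)⟩, rfl⟩
  obtain ⟨f', hf'⟩ := GrMod.exists_lift ((DMod n m e).subtype (GrMod.range f))
    (GrMod.range f).toSubmodule.subtype_injective f fun x => ⟨⟨_, x, rfl⟩, rfl⟩
  have hsf : Function.Surjective (GrMod.lin f') := by
    rintro ⟨_, x, rfl⟩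
    exact ⟨x, Subtype.ext (LinearMap.congr_fun (congrArg GrMod.lin hf') x)⟩
  have := GrMod.epi_of_surjective f' hsf
  -- So `g` factors through the image of `f`, and projectivity lifts it to `T`.
  refine ⟨Projective.factorThru g' f', fun h0 => hg ?_⟩
  rw [← hg', ← Projective.factorThru_comp g' f', h0, zero_comp, zero_comp]

end skew

/-! ### Dimensions of Hom spaces: exact sequences and shifts -/

namespace CategoryTheory

universe v u

/-- Left exactness of `Hom(-, Y)`. Cardinal ranks are used because finite-dimensionality of
`Hom(N_l, D)` is obtained from this bound and not known beforehand. -/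
theorem rank_hom_le {k : Type v} [Field k] {C : Type u} [Category.{v} C] [Abelian C] [Linear k C]
    {S : ShortComplex C} (hS : S.ShortExact) (Y : C) :
    Module.rank k (S.X₂ ⟶ Y) ≤ Module.rank k (S.X₃ ⟶ Y) + Module.rank k (S.X₁ ⟶ Y) := by
  have := hS.epi_g
  rw [← LinearMap.rank_range_add_rank_ker (Linear.leftComp k Y S.f), add_comm]
  refine add_le_add (le_trans (Submodule.rank_mono ?_) (LinearMap.rank_le_domain (Linear.leftComp k Y S.g)))
    (Submodule.rank_le _)
  intro f hf
  exact ⟨hS.exact.desc f hf, hS.exact.g_desc f hf⟩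

end CategoryTheory

namespace GrMod

variable {k : Type uk} {A : Type uA} [Field k] [Ring A] [Algebra k A] {𝒜 : ℤ → Submodule k A}

/-- Homomorphisms between shifts. -/
def shiftHomEquiv (M N : GrMod 𝒜) (d e : ℤ) :
    (M ⟶ N.shift (e - d)) ≃ₗ[k] (M.shift d ⟶ N.shift e) :=
  (LinearEquiv.ofBijective
    ({ toFun := fun f => shiftHom f d
       map_add' := fun _ _ => rfl
       map_smul' := fun _ _ => rfl } :
      (M ⟶ N.shift (e - d)) →ₗ[k] (M.shift d ⟶ (N.shift (e - d)).shift d))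
    ⟨shiftHom_injective d, shiftHom_surjective⟩).trans
    (Linear.homCongr k (Iso.refl _) (N.shiftShift (e - d) d e (by simp)))

end GrMod

section skew

variable {W : Type uA} [Group W] {n : ℕ} [MulSemiringAction W (PolyRing n)]
  [SMulCommClass W ℂ (PolyRing n)] [PreservesDegree W n]
  [FiniteDimensional ℂ (PolyRing n ⧸ invariantIdeal W n)] [Preorder (Irr W)]

/-! ## Orthogonality -/

theorem finrank_PMod_hom_DMod (hW : SelfDual W) (l m : Irr W) (e : ℤ) :
    Module.finrank ℂ (PMod n l ⟶ DMod n m e) = gradedMult (KMod n m) l e := by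
  rw [← sub_zero e, ← finrank_hom_DMod hW, sub_zero]
  exact (Linear.homCongr ℂ (PMod n l).shiftZero (Iso.refl (DMod n m e))).finrank_eq.symm

instance (l m : Irr W) (e : ℤ) : FiniteDimensional ℂ (PMod n l ⟶ DMod n m e) :=
  Module.Finite.equiv (Linear.homCongr ℂ (PMod n l).shiftZero (Iso.refl (DMod n m e)))

variable [Finite W]

/-- In nonpositive degrees, homomorphisms from `K̃_l` are homomorphisms from `P_l`. -/
def KtModHomEquiv (l m : Irr W) {e : ℤ} (he : e ≤ 0) :
    (KtMod n l ⟶ DMod n m e) ≃ₗ[ℂ] (PMod n l ⟶ DMod n m e) :=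
  LinearEquiv.ofBijective
    (Linear.leftComp ℂ (DMod n m e) (show PMod n l ⟶ KtMod n l from (PMod n l).mkQ _))
    ⟨fun f g h => by
      have := epi_mkQ (n := n) l
      exact (cancel_epi _).1 h, fun f => by
      refine GrMod.exists_desc ((PMod n l).mkQ (traceSub n {m | l < m} l))
        (GrMod.mkQ_surjective _ _) f fun x hx => ?_
      -- The kernel of `P_l → K̃_l` lives in degrees at least `1`, the target in degrees at most `e
      -- ≤ 0`.
      have h : (PMod n l).subtype (traceSub n {m | l < m} l) ≫ f = 0 :=
        GrMod.hom_eq_zero (c := 0) (traceSub_isGE _ l) ((DMod_isLE m e).mono he) _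
      exact LinearMap.congr_fun (congrArg GrMod.lin h) ⟨x, GrMod.mkQ_eq_zero_iff.1 hx⟩⟩

theorem finrank_KtMod_hom_DMod (hW : SelfDual W) (l m : Irr W) {e : ℤ} (he : e ≤ 0) :
    Module.finrank ℂ (KtMod n l ⟶ DMod n m e) = gradedMult (KMod n m) l e := by
  rw [(KtModHomEquiv l m he).finrank_eq, finrank_PMod_hom_DMod hW]

theorem subsingleton_KtMod_hom_DMod (hW : SelfDual W) {l m : Irr W} {e : ℤ} (he : e ≤ 0)
    (h : ¬ (e = 0 ∧ l = m)) : Subsingleton (KtMod n l ⟶ DMod n m e) := by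
  have : FiniteDimensional ℂ (KtMod n l ⟶ DMod n m e) :=
    Module.Finite.equiv (KtModHomEquiv l m he).symm
  rw [← Module.finrank_zero_iff (R := ℂ), finrank_KtMod_hom_DMod hW l m he]
  by_contra h0
  rcases of_gradedMult_KMod_ne_zero h0 with h1 | ⟨h1, -⟩
  · exact h h1
  · omega

theorem finrank_KtMod_hom_DMod_self (hW : SelfDual W) (m : Irr W) :
    Module.finrank ℂ (KtMod n m ⟶ DMod n m 0) = 1 := by
  classical
  rw [finrank_KtMod_hom_DMod hW m m le_rfl, gradedMult_KMod_zero, if_pos rfl]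

theorem subsingleton_ext_KtMod_of_nonpos (l m : Irr W) {e : ℤ} (he : e ≤ 0) (i : ℕ) :
    Subsingleton (Abelian.Ext (KtMod n l) (DMod n m e) (i + 1)) :=
  subsingleton_ext_KtMod_of_sub l i
    (subsingleton_ext_of_deg ((DMod_isLE m e).mono he) i (traceSub_isGE _ l))

theorem subsingleton_ext_shift_DMod {M : SkewMod W n} {m : Irr W} {d e : ℤ} {i : ℕ}
    (h : Subsingleton (Abelian.Ext M (DMod n m (e - d)) i)) :
    Subsingleton (Abelian.Ext (M.shift d) (DMod n m e) i) :=
  Abelian.Ext.subsingleton_of_iso (Iso.refl _)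
    ((dualModule (KMod n m)).shiftShift (e - d) d e (by simp)) i
    (GrMod.subsingleton_ext_shift M (DMod n m (e - d)) d i h)

variable (W n) in
/-- The orthogonality of the strict trace quotients and the duals of the trace quotients in the
positive degree `e`. -/
structure Orthogonal (e : ℤ) : Prop where
  -- Carried along for the induction: it sharpens `¬ m ≤ l` to `l < m`, which is transitive and
  -- matches the strict trace in `K̃_l`.
  lt_of_mult : ∀ l m : Irr W, gradedMult (KMod n m) l e ≠ 0 → l < m
  hom : ∀ l m : Irr W, Subsingleton (KtMod n l ⟶ DMod n m e)
  ext : ∀ (l m : Irr W) (i : ℕ), Subsingleton (Abelian.Ext (KtMod n l) (DMod n m e) (i + 1))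

/-! ### The inductive step: filtrations with factors in positive degrees -/

section induction

variable {e : ℤ} (ih : ∀ d, 0 < d → d < e → Orthogonal W n d)
include ih

theorem ext_of_lt (l m : Irr W) {d : ℤ} (hd : d < e) (i : ℕ) :
    Subsingleton (Abelian.Ext (KtMod n l) (DMod n m d) (i + 1)) := by
  rcases le_or_gt d 0 with h | h
  · exact subsingleton_ext_KtMod_of_nonpos l m h i
  · exact (ih d h hd).ext l m i

theorem hom_of_lt (hW : SelfDual W) {l m : Irr W} {d : ℤ} (hd : d < e) (h : ¬ (d = 0 ∧ l = m)) :
    Subsingleton (KtMod n l ⟶ DMod n m d) := by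
  rcases le_or_gt d 0 with h' | h'
  · exact subsingleton_KtMod_hom_DMod hW h' h
  · exact (ih d h' hd).hom l m

/-- Moving the shift `d > 0` to the target lowers `e` to `e - d`, where vanishing is already known.
-/
theorem ext_of_factor {F : SkewMod W n} (m : Irr W)
    (hF : IsZero F ∨ ∃ a d, 0 < d ∧ Nonempty (F ≅ (KtMod n a).shift d)) (i : ℕ) :
    Subsingleton (Abelian.Ext F (DMod n m e) (i + 1)) := by
  rcases hF with hF | ⟨a, d, hd, ⟨u⟩⟩
  · have : Projective F := hF.projective
    exact Abelian.Ext.subsingleton_of_projective _ _ _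
  · exact Abelian.Ext.subsingleton_of_iso u.symm (Iso.refl _) _
      (subsingleton_ext_shift_DMod (ext_of_lt ih a m (by omega) i))

/-- After moving the shift to the target, a nonzero map out of `K̃_a` requires `e - d = 0` and `a =
m`, and then there is one up to scalars. -/
theorem rank_hom_of_factor (hW : SelfDual W) {F : SkewMod W n} (m : Irr W)
    [Decidable (Nonempty (F ≅ (KtMod n m).shift e))]
    (hF : IsZero F ∨ ∃ a d, 0 < d ∧ Nonempty (F ≅ (KtMod n a).shift d)) :
    Module.rank ℂ (F ⟶ DMod n m e) ≤
      ((if Nonempty (F ≅ (KtMod n m).shift e) then 1 else 0 : ℕ) : Cardinal) := by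
  split_ifs with hP
  · obtain ⟨u⟩ := hP
    rw [(Linear.homCongr ℂ u (Iso.refl (DMod n m e))).rank_eq,
      ← (GrMod.shiftHomEquiv (KtMod n m) (dualModule (KMod n m)) e e).rank_eq, sub_self,
      Module.rank_eq_one_iff_finrank_eq_one.2 (finrank_KtMod_hom_DMod_self hW m), Nat.cast_one]
  · have : Subsingleton (F ⟶ DMod n m e) := by
      rcases hF with hF | ⟨a, d, hd, ⟨u⟩⟩
      · exact ⟨fun f g => hF.eq_of_src f g⟩
      · have : Subsingleton (KtMod n a ⟶ DMod n m (e - d)) := by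
          refine hom_of_lt ih hW (by omega) ?_
          rintro ⟨h, rfl⟩
          obtain rfl : e = d := by omega
          exact hP ⟨u⟩
        exact ((Linear.homCongr ℂ u (Iso.refl (DMod n m e))).trans
          (GrMod.shiftHomEquiv (KtMod n a) (dualModule (KMod n m)) d e).symm).injective.subsingleton
    rw [rank_subsingleton', Nat.cast_zero]

variable {l : Irr W} {Φ : GrMod.Filtration (PMod n l)} {j : ℕ}
  (hfac : ∀ i ≥ j, IsZero (Φ.factor i) ∨
    ∃ a d, 0 < d ∧ Nonempty (Φ.factor i ≅ (KtMod n a).shift d))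
include hfac

/-- The map extends from each step to the preceding, larger one, because the factor between them has
no `Ext¹` to the target. -/
theorem exists_hom_step_ne_zero (m : Irr W) {i : ℕ} (hi : j ≤ i)
    (f : (PMod n l).sub (Φ.step i) ⟶ DMod n m e) (hf : f ≠ 0) :
    ∃ g : (PMod n l).sub (Φ.step j) ⟶ DMod n m e, g ≠ 0 := by
  induction i, hi using Nat.le_induction with
  | base => exact ⟨f, hf⟩
  | succ i hi h =>
    obtain ⟨g, hg⟩ := Abelian.Ext.exists_extension (Φ.complex_shortExact i) (DMod n m e)
      (ext_of_factor ih m (hfac i hi) 0) f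
    refine h g fun h0 => hf ?_
    rw [← hg, h0]
    exact comp_zero

/-- Descending induction from a step so deep that it lies in degrees above `e`, where `Ext` vanishes
by degrees; `t` bounds the distance to that step. This replaces the infinite filtration by a finite
one. -/
theorem ext_step (m : Irr W) {j₀ : ℕ} (hj₀ : ∀ i ≥ j₀, ((PMod n l).sub (Φ.step i)).IsGE (e + 1))
    (p t : ℕ) : ∀ i ≥ j, j₀ ≤ i + t →
      Subsingleton (Abelian.Ext ((PMod n l).sub (Φ.step i)) (DMod n m e) (p + 1)) := by
  induction t with
  | zero => exact fun i _ hi => subsingleton_ext_of_deg (DMod_isLE m e) _ (hj₀ i hi)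
  | succ t h =>
    intro i hi hit
    exact Abelian.Ext.subsingleton_middle (Φ.complex_shortExact i) _ _
      (h (i + 1) (by omega) (by omega)) (ext_of_factor ih m (hfac i hi) p)

open Classical in
-- The same descent, adding up the contributions of the factors; each copy of `K̃_m⟨e⟩` contributes
-- at most one.
theorem rank_hom_step (hW : SelfDual W) (m : Irr W) {j₀ : ℕ}
    (hj₀ : ∀ i ≥ j₀, ((PMod n l).sub (Φ.step i)).IsGE (e + 1)) (t : ℕ) :
    ∀ i ≥ j, j₀ ≤ i + t → Module.rank ℂ ((PMod n l).sub (Φ.step i) ⟶ DMod n m e) ≤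
      ((∑ x ∈ Finset.Ico i (i + t),
        if Nonempty (Φ.factor x ≅ (KtMod n m).shift e) then 1 else 0 : ℕ) : Cardinal) := by
  induction t with
  | zero =>
    intro i _ hi
    have : Subsingleton ((PMod n l).sub (Φ.step i) ⟶ DMod n m e) :=
      subsingleton_of_forall_eq 0 fun f => GrMod.hom_eq_zero (hj₀ i hi) (DMod_isLE m e) f
    rw [rank_subsingleton']
    exact bot_le
  | succ t h =>
    intro i hi hit
    rw [Finset.sum_eq_sum_Ico_succ_bot (by omega), Nat.cast_add,
      show i + (t + 1) = i + 1 + t by omega]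
    exact (rank_hom_le (Φ.complex_shortExact i) (DMod n m e)).trans
      (add_le_add (rank_hom_of_factor ih hW m (hfac i hi)) (h (i + 1) (by omega) (by omega)))

end induction

/-- The trace quotients are orthogonal in all positive degrees. -/
theorem orthogonal (hW : SelfDual W)
    (hmult : ∀ l : Irr W, (PMod n l).IsFilteredWithMultiplicity (KtMod n)
      (fun m d => gradedMult (KMod n m) l d)) (N : ℕ) :
    ∀ e : ℤ, 0 < e → e ≤ N → Orthogonal W n e := by
  classical
  induction N with
  | zero => intro e h0 h1; exact absurd h1 (by push_cast; omega)
  | succ N hN =>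
  intro e he heN
  have ih : ∀ d, 0 < d → d < e → Orthogonal W n d := fun d h0 h1 =>
    hN d h0 (by push_cast at heN; omega)
  have hlt : ∀ l m : Irr W, gradedMult (KMod n m) l e ≠ 0 → l < m := by
    intro l m h
    obtain ⟨Φ, j, hj, hfac, hcard, -⟩ := exists_traceSub_filtration (hmult l)
    -- The multiplicity hypothesis produces a factor `K̃_m⟨e⟩` of the trace submodule.
    have hne : {i | j ≤ i ∧ Nonempty (Φ.factor i ≅ (KtMod n m).shift e)}.Nonempty := by
      rw [← Set.encard_ne_zero, hcard m e he]
      exact_mod_cast h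
    obtain ⟨i, hi, ⟨u⟩⟩ := hne
    have : Nontrivial ((KtMod n m).shift e ⟶ DMod n m e) := by
      refine Module.nontrivial_of_finrank_pos (R := ℂ) ?_
      rw [← (GrMod.shiftHomEquiv (KtMod n m) (dualModule (KMod n m)) e e).finrank_eq, sub_self,
        finrank_KtMod_hom_DMod_self hW]
      exact zero_lt_one
    obtain ⟨f, hf⟩ := exists_ne (0 : (KtMod n m).shift e ⟶ DMod n m e)
    have := (Φ.complex_shortExact i).epi_g
    have hg : ((Φ.complex i).g ≫ u.hom ≫ f : (Φ.complex i).X₂ ⟶ DMod n m e) ≠ 0 := fun h0 =>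
      hf ((cancel_epi u.hom).1 ((cancel_epi (Φ.complex i).g).1
        ((h0.trans comp_zero.symm).trans (congrArg _ comp_zero.symm))))
    have hex := exists_hom_step_ne_zero ih hfac m hi _ hg
    rw [hj] at hex
    obtain ⟨g, hg⟩ := hex
    by_contra hlm
    -- If `l < m` failed, every `P_a⟨d⟩` with `l < a`, `d > 0` would map to zero: a nonzero map
    -- gives `a = m`, or `a < m` by induction in degree `e - d`.
    refine hg (hom_traceSub_ext g fun a ha d hd v => ?_)
    refine PMod_shift_hom_DMod_eq_zero hW ?_ (v ≫ g)
    by_contra h0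
    rcases of_gradedMult_KMod_ne_zero h0 with ⟨-, rfl⟩ | ⟨h1, -⟩
    · exact hlm ha
    · exact hlm (lt_trans ha ((ih (e - d) h1 (by omega)).lt_of_mult a m h0))
  have hhom : ∀ l m : Irr W, Subsingleton (KtMod n l ⟶ DMod n m e) := by
    intro l m
    refine subsingleton_of_forall_eq 0 fun f => ?_
    by_contra hf
    have := epi_mkQ (n := n) l
    have hlm : l < m := hlt l m fun h0 => hf (by
      rw [← finrank_PMod_hom_DMod hW, Module.finrank_zero_iff] at h0
      exact (cancel_epi (show PMod n l ⟶ KtMod n l from (PMod n l).mkQ _)).1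
        (Subsingleton.elim _ _))
    -- The socle of the target lifts to a nonzero map `P_m⟨e⟩ → K̃_l`, which `l < m` and `e > 0`
    -- forbid.
    obtain ⟨h, hh⟩ := exists_hom_ne_zero hW hf
    exact hh (hom_traceQuot_eq_zero (T := {x | l < x}) hlm he h)
  refine ⟨hlt, hhom, fun l m i => ?_⟩
  obtain ⟨Φ, j, hj, hfac, hcard, htail⟩ := exists_traceSub_filtration (hmult l)
  obtain ⟨j₀, hj₀⟩ := htail (e + 1)
  cases i with
  | succ i =>
    have := ext_step ih hfac m hj₀ i j₀ j le_rfl (by omega)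
    rw [hj] at this
    exact subsingleton_ext_KtMod_of_sub l (i + 1) this
  | zero =>
    have hrank := rank_hom_step ih hfac hW m hj₀ j₀ j le_rfl (by omega)
    -- Only finitely many of the factors are counted here, hence an inequality; injectivity of the
    -- restriction `r` supplies the reverse bound on dimensions.
    have hsum : (∑ x ∈ Finset.Ico j (j + j₀),
        if Nonempty (Φ.factor x ≅ (KtMod n m).shift e) then 1 else 0) ≤
        gradedMult (KMod n m) l e := by
      rw [← Finset.card_filter, ← Nat.cast_le (α := ℕ∞), ← hcard m e he,
        ← Set.encard_coe_eq_coe_finsetCard]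
      refine Set.encard_le_encard fun x hx => ?_
      rw [Finset.mem_coe, Finset.mem_filter, Finset.mem_Ico] at hx
      exact ⟨hx.1.1, hx.2⟩
    rw [hj] at hrank
    have hrank' := hrank.trans (Nat.cast_le.2 hsum)
    have : FiniteDimensional ℂ ((PMod n l).sub (traceSub n {m | l < m} l) ⟶ DMod n m e) :=
      Module.rank_lt_aleph0_iff.1 (hrank'.trans_lt Cardinal.natCast_lt_aleph0)
    let r := Linear.leftComp ℂ (DMod n m e) ((PMod n l).subtype (traceSub n {m | l < m} l))
    have hr : Function.Injective r := by
      refine (injective_iff_map_eq_zero r).2 fun f hf => ?_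
      obtain ⟨f', hf'⟩ := GrMod.exists_desc ((PMod n l).mkQ (traceSub n {m | l < m} l))
        (GrMod.mkQ_surjective _ _) f fun x hx =>
          LinearMap.congr_fun (congrArg GrMod.lin hf) ⟨x, GrMod.mkQ_eq_zero_iff.1 hx⟩
      have := hhom l m
      rw [← hf', show f' = 0 from Subsingleton.elim (α := KtMod n l ⟶ DMod n m e) _ _, comp_zero]
    have hdim : Module.finrank ℂ (PMod n l ⟶ DMod n m e) =
        Module.finrank ℂ ((PMod n l).sub (traceSub n {m | l < m} l) ⟶ DMod n m e) := by
      refine le_antisymm (LinearMap.finrank_le_finrank_of_injective hr) ?_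
      rw [finrank_PMod_hom_DMod hW]
      exact Module.finrank_le_of_rank_le hrank'
    -- Every map on the trace submodule therefore extends to `P_l`, which is what vanishing of
    -- `Ext¹` requires.
    have hsurj := (LinearMap.injective_iff_surjective_of_finrank_eq_finrank hdim).1 hr
    have : Projective ((PMod n l).subComplex (traceSub n {m | l < m} l)).X₂ :=
      inferInstanceAs (Projective (PMod n l))
    exact Abelian.Ext.subsingleton_one_of_extension
      ((PMod n l).subComplex_shortExact (traceSub n {m | l < m} l)) (DMod n m e) hsurj

end skew

end

/-! ### The main theorem -/

theorem mainTheorem3 {W : Type*} [Group W] [Finite W] (n : ℕ)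
    [MulSemiringAction W (PolyRing n)] [SMulCommClass W ℂ (PolyRing n)] [PreservesDegree W n]
    [FiniteDimensional ℂ (PolyRing n ⧸ invariantIdeal W n)]
    (selfDual : ∀ (V : Type) [AddCommGroup V] [Module ℂ V] [FiniteDimensional ℂ V]
      (ρ : Representation ℂ W V), Nonempty (ρ.Equiv ρ.dual))
    [DecidableEq (Irr W)] [Preorder (Irr W)]
    (hPKt : ∀ l : Irr W, (PMod n l).IsFilteredBy (KtMod n))
    (hKtK : ∀ l : Irr W, (KtMod n l).IsFilteredBy (KMod n))
    (hmult : ∀ l : Irr W, (PMod n l).IsFilteredWithMultiplicity (KtMod n)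
      (fun m d => gradedMult (KMod n m) l d)) :
    ∀ (i : ℕ) (l m : Irr W) (d : ℤ),
      Module.rank ℂ (GrMod.GExt (KtMod n l) (dualModule (KMod n m)) i d) =
        if i = 0 ∧ l = m ∧ d = 0 then 1 else 0 := by
  intro i l m d
  have horth : ∀ e : ℤ, 0 < e → Orthogonal W n e := fun e he =>
    orthogonal selfDual hmult e.toNat e he (Int.self_le_toNat e)
  -- Degree `d` of `Ext` is the case `e = -d` of the orthogonality statements.
  change Module.rank ℂ (Abelian.Ext (KtMod n l) (DMod n m (-d)) i) = _
  cases i with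
  | succ i =>
    rw [if_neg (by simp)]
    have : Subsingleton (Abelian.Ext (KtMod n l) (DMod n m (-d)) (i + 1)) := by
      rcases le_or_gt (-d) 0 with h | h
      · exact subsingleton_ext_KtMod_of_nonpos l m h i
      · exact (horth _ h).ext l m i
    exact rank_subsingleton' ..
  | zero =>
    split_ifs with h
    · obtain ⟨-, rfl, rfl⟩ := h
      rw [neg_zero, Module.rank_eq_one_iff_finrank_eq_one,
        (Abelian.Ext.linearEquiv₀ (R := ℂ)).finrank_eq]
      exact finrank_KtMod_hom_DMod_self selfDual l
    · have : Subsingleton (KtMod n l ⟶ DMod n m (-d)) := by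
        rcases le_or_gt (-d) 0 with h' | h'
        · refine subsingleton_KtMod_hom_DMod selfDual h' fun hc => h ⟨rfl, hc.2, by omega⟩
        · exact (horth _ h').hom l m
      have : Subsingleton (Abelian.Ext (KtMod n l) (DMod n m (-d)) 0) :=
        Abelian.Ext.addEquiv₀.injective.subsingleton
      exact rank_subsingleton' ..
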